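/- Let $k$ be an algebraically closed field of characteristic $p>0$, let $e>0$ and $q=p^e$, and let $$L_i(T)=\alpha_{i e}T^{p^e}+\alpha_{i\,e-1}T^{p^{e-1}}+\cdots+\alpha_{i 0}T\in k[T],\qquad \alpha_{ie}\,\alpha_{i0}\neq 0\qquad(i=1,2)$$ be two linearized polynomials of degree $q$, and let $c\in k\setminus\{0\}$. Let $X$ be the smooth projective model of the plane curve $C$ with affine equation $L_1(x)L_2(y)+c=0$, with function field $k(X)=k(x,y)$, where $x=X_0/Z$, $y=X_1/Z$ for the homogeneous coordinates $(X_0:X_1:Z)$ of $\mathbb P^2$. Let $D$ be the divisor on $X$ given by the line $Z=0$, that is, the pullback of this line under the morphism $(x:y:1):X\to C\subset\mathbb P^2$. Then the morphism $$\varphi: X\to\mathbb P^3,\qquad \varphi=(x:y:1:xy),$$ is an embedding (an isomorphism of $X$ onto a closed subvariety of $\mathbb P^3$), and the linear system induced by $\varphi$ is complete: the set of all divisors $\varphi^*H$, where $H\subset\mathbb P^3$ runs through the planes not containing $\varphi(X)$, is the complete linear system $|D|$ of all effective divisors linearly equivalent to $D$. Moreover, $$\mathcal L(D)=\{f\in k(X):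 f=0\ \text{or}\ \operatorname{div}(f)+D\ge 0\}=\langle 1,x,y,xy\rangle_k .$$ -/

import Mathlib

open scoped LinearAlgebra.Projectivization WithZero

noncomputable section

/-! ## Classical algebraic geometry over an algebraically closed field -/

namespace AlgCurve

universe u v

/-- A discrete valuation ring of `K / k`: a valuation subring of `K` that contains `k` and is a
discrete valuation ring (in particular it is not `K` itself). When `K` is an algebraic function
field of one variable over the algebraically closed field `k`, these are the points of the smooth
projective model of `K / k`. -/
@[ext]
structure Place (k : Type u) (K : Type v) [Field k] [Field K] [Algebra k K] where
  ring : ValuationSubring K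
  isDVR : IsDiscreteValuationRing ring
  algebraMap_mem : ∀ a : k, algebraMap k K a ∈ ring

section Places

variable {k : Type u} {K : Type v} [Field k] [Field K] [Algebra k K]

/-- The normalized discrete valuation of a place, written multiplicatively:
`val P f = exp (- ord_P f)` for `f ≠ 0`, and `val P 0 = 0`. -/
def Place.val (P : Place k K) : Valuation K ℤᵐ⁰ :=
  letI := P.isDVR
  (IsDiscreteValuationRing.maximalIdeal P.ring).valuation K

/-- The order of vanishing `ord_P f` of a function `f ≠ 0` (it has the value `0` at `f = 0`). -/
def Place.ord (P : Place k K) (f : K) : ℤ := - WithZero.log (P.val f)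

theorem Place.val_le_one_iff (P : Place k K) (f : K) : P.val f ≤ 1 ↔ f ∈ P.ring := by
  have := P.isDVR
  constructor
  · intro h
    obtain ⟨a, ha⟩ := IsDiscreteValuationRing.exists_lift_of_le_one (A := P.ring) (K := K) h
    rw [← ha]
    exact a.2
  · intro h
    exact IsDedekindDomain.HeightOneSpectrum.valuation_le_one
      (IsDiscreteValuationRing.maximalIdeal P.ring) (⟨f, h⟩ : P.ring)

/-- `f` is regular at `P` with value `f(P) = a`, i.e. `f - a` lies in the maximal ideal of the
local ring of `P`. -/
def Place.HasValue (P : Place k K) (f : K) (a : k) : Prop :=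
  P.val (f - algebraMap k K a) < 1

/-- The Zariski topology on the set of points of the smooth curve: the proper closed subsets are
the finite sets of points. -/
instance placeTopology : TopologicalSpace (Place k K) := TopologicalSpace.cofinite

/-- A `k`-valued function `h` is regular on the open set `U` of the curve: locally it is given by
the values of an element of the function field that is regular there. -/
def IsRegularOn (U : Set (Place k K)) (h : Place k K → k) : Prop :=
  ∀ P ∈ U, ∃ W : Set (Place k K), IsOpen W ∧ P ∈ W ∧
    ∃ f : K, ∀ Q ∈ W ∩ U, Q.HasValue f (h Q)

/-- The value at `P` of the map `(f₀ : ⋯ : fₙ)` from the curve to `ℙⁿ` is the point `p`: after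
multiplication of all the coordinates by a common function `t ≠ 0`, they become regular at `P`
and their values at `P` are the homogeneous coordinates of `p`. -/
def Place.MapsTo {n : ℕ} (P : Place k K) (f : Fin (n + 1) → K)
    (p : ℙ k (Fin (n + 1) → k)) : Prop :=
  ∃ t : K, t ≠ 0 ∧ ∀ i, P.HasValue (t * f i) (p.rep i)

end Places

section ProjectiveSpace

variable {k : Type u} [Field k] {n : ℕ}

/-- The Zariski topology on the set of points of `ℙⁿ` over `k`: it is generated by the
complements of the hypersurfaces `F = 0`. -/
instance zariskiTopology : TopologicalSpace (ℙ k (Fin (n + 1) → k)) :=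
  TopologicalSpace.generateFrom
    {U | ∃ (d : ℕ) (F : MvPolynomial (Fin (n + 1)) k), F.IsHomogeneous d ∧
      U = {p | MvPolynomial.eval p.rep F ≠ 0}}

/-- A `k`-valued function `h` is regular on the locally closed subset `V` of `ℙⁿ`: locally on `V`
it is a quotient of two homogeneous polynomials of the same degree whose denominator has no
zero there. -/
def IsRegularOnProj (V : Set (ℙ k (Fin (n + 1) → k))) (h : ℙ k (Fin (n + 1) → k) → k) : Prop :=
  ∀ p ∈ V, ∃ W : Set (ℙ k (Fin (n + 1) → k)), IsOpen W ∧ p ∈ W ∧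
    ∃ (d : ℕ) (F G : MvPolynomial (Fin (n + 1)) k), F.IsHomogeneous d ∧ G.IsHomogeneous d ∧
      ∀ r ∈ W ∩ V, MvPolynomial.eval r.rep G ≠ 0 ∧
        h r = MvPolynomial.eval r.rep F / MvPolynomial.eval r.rep G

end ProjectiveSpace

section Maps

variable {k : Type u} {K : Type v} [Field k] [Field K] [Algebra k K] {n : ℕ}

/-- `φ` is an embedding of the curve into `ℙⁿ`: its image is closed, and `φ` is an isomorphism of
varieties onto its image, i.e. a homeomorphism onto the image for the Zariski topologies under
which the regular functions on corresponding open sets correspond to each other. -/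
structure IsEmbedding (φ : Place k K → ℙ k (Fin (n + 1) → k)) : Prop where
  isClosedEmbedding : Topology.IsClosedEmbedding φ
  regular_iff : ∀ (U : Set (Place k K)), IsOpen U → ∀ h : ℙ k (Fin (n + 1) → k) → k,
    (IsRegularOnProj (φ '' U) h ↔ IsRegularOn U (h ∘ φ))

/-- The smallest order at `P` of the functions `f₀, …, fₙ` (not all `0`). -/
def Place.minOrd (P : Place k K) (f : Fin (n + 1) → K) : ℤ :=
  - WithZero.log (Finset.univ.sup fun i => P.val (f i))

/-- The divisor on the curve cut out by the hyperplane `a₀ X₀ + ⋯ + aₙ Xₙ = 0` under the map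
`(f₀ : ⋯ : fₙ)`, as a function on the points: its multiplicity at `P` is
`ord_P (∑ aᵢ fᵢ) - minᵢ ord_P (fᵢ)`. It is meaningful if `∑ aᵢ fᵢ ≠ 0`, i.e. if the image of the
curve is not contained in the hyperplane. -/
def hyperplaneDivisor (f : Fin (n + 1) → K) (a : Fin (n + 1) → k) : Place k K → ℤ :=
  fun P => P.ord (∑ i, a i • f i) - P.minOrd f

/-- The linear system induced by the map `(f₀ : ⋯ : fₙ)`: the set of the divisors cut out by the
hyperplanes that do not contain the image of the curve. -/
def inducedLinearSystem (k : Type u) {K : Type v} [Field k] [Field K] [Algebra k K]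
    (f : Fin (n + 1) → K) : Set (Place k K → ℤ) :=
  {E | ∃ a : Fin (n + 1) → k, ∑ i, a i • f i ≠ 0 ∧ E = hyperplaneDivisor f a}

/-- The complete linear system `|D|`: the effective divisors that are linearly equivalent
to `D`. -/
def completeLinearSystem (D : Place k K → ℤ) : Set (Place k K → ℤ) :=
  {E | 0 ≤ E ∧ ∃ g : K, g ≠ 0 ∧ ∀ P, E P = D P + P.ord g}

/-- The Riemann–Roch space `L(D)`: the functions `f` with `f = 0` or `ord_P f ≥ - D(P)` for all
points `P`; in terms of the valuations, `val P f ≤ exp (D P)`. -/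
def riemannRochSpace (D : Place k K → ℤ) : Submodule k K where
  carrier := {f | ∀ P : Place k K, P.val f ≤ WithZero.exp (D P)}
  zero_mem' := fun P => by simp
  add_mem' := fun hf hg P => Valuation.map_add_le _ (hf P) (hg P)
  smul_mem' := fun a f hf P => by
    rw [Algebra.smul_def, map_mul]
    calc P.val (algebraMap k K a) * P.val f ≤ 1 * P.val f :=
          mul_le_mul_left ((P.val_le_one_iff _).2 (P.algebraMap_mem a)) _
      _ = P.val f := one_mul _
      _ ≤ _ := hf P

end Maps

end AlgCurve

/-! ## Generalized Artin–Schreier–Mumford curves -/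

/-- The data of a generalized Artin–Schreier–Mumford curve `L₁(x) L₂(y) + c = 0` over `k`: an
exponent `e > 0`, the coefficients `α₁ 0, …, α₁ e` and `α₂ 0, …, α₂ e` of two linearized
polynomials of degree `p ^ e` with nonzero linear coefficients, and a constant `c ≠ 0`. -/
structure GenASM (k : Type*) [Field k] where
  e : ℕ
  e_pos : 0 < e
  α₁ : ℕ → k
  α₂ : ℕ → k
  c : k
  α₁_zero_ne : α₁ 0 ≠ 0
  α₁_e_ne : α₁ e ≠ 0
  α₂_zero_ne : α₂ 0 ≠ 0
  α₂_e_ne : α₂ e ≠ 0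
  c_ne : c ≠ 0

namespace GenASM

universe u

open Polynomial

/-- The linearized polynomial `α e * T ^ (p ^ e) + ⋯ + α 1 * T ^ p + α 0 * T`. -/
def linearized {k : Type u} [Field k] (p e : ℕ) (α : ℕ → k) : k[X] :=
  ∑ j ∈ Finset.range (e + 1), C (α j) * X ^ p ^ j

variable {k : Type u} [Field k] (S : GenASM k) (p : ℕ)

/-- The defining polynomial `L₁(x) L₂(y) + c`, as a polynomial in `y` over `k[x]`. -/
def polynomial : k[X][X] :=
  C (linearized p S.e S.α₁) * (linearized p S.e S.α₂).map C + C (C S.c)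

theorem eval_zero_linearized (hp : p.Prime) (e : ℕ) (α : ℕ → k) :
    (linearized p e α).eval 0 = 0 := by
  simp [linearized, eval_finsetSum, hp.ne_zero]

theorem coeff_one_linearized (hp : p.Prime) (e : ℕ) (α : ℕ → k) :
    (linearized p e α).coeff 1 = α 0 := by
  simp only [linearized, finsetSum_coeff, coeff_C_mul, coeff_X_pow]
  rw [Finset.sum_eq_single 0]
  · simp
  · intro j _ hj
    have : 1 ≠ p ^ j := (Nat.one_lt_pow hj hp.one_lt).ne
    simp [this]
  · simp

theorem natDegree_linearized (hp : p.Prime) (e : ℕ) (α : ℕ → k) (h : α e ≠ 0) :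
    (linearized p e α).natDegree = p ^ e := by
  rw [linearized, Finset.sum_range_succ]
  have h1 : (C (α e) * X ^ p ^ e).degree = ((p ^ e : ℕ) : WithBot ℕ) := degree_C_mul_X_pow _ h
  apply natDegree_eq_of_degree_eq_some
  rw [degree_add_eq_right_of_degree_lt, h1]
  rw [h1]
  refine (degree_sum_le _ _).trans_lt ((Finset.sup_lt_iff (WithBot.bot_lt_coe _)).2 ?_)
  intro j hj
  refine (degree_C_mul_X_pow_le _ _).trans_lt ?_
  exact_mod_cast Nat.pow_lt_pow_right hp.one_lt (Finset.mem_range.1 hj)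

theorem irreducible_polynomial (hp : p.Prime) : Irreducible (S.polynomial p) := by
  set A := linearized p S.e S.α₁ with hA
  set B := linearized p S.e S.α₂ with hB
  have hA0 : A ≠ 0 := by
    intro h
    have := coeff_one_linearized p hp S.e S.α₁
    rw [← hA, h] at this
    exact S.α₁_zero_ne (by simpa using this.symm)
  have hBdeg : B.natDegree = p ^ S.e := natDegree_linearized p hp _ _ S.α₂_e_ne
  have hBpos : 0 < B.natDegree := by rw [hBdeg]; exact pow_pos hp.pos _
  have hB0 : B ≠ 0 := fun h => by simp [h] at hBpos
  have hmain : (C A * B.map C).natDegree = B.natDegree := by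
    rw [natDegree_C_mul hA0, natDegree_map_eq_of_injective C_injective]
  have hdeg : (S.polynomial p).natDegree = B.natDegree := by
    rw [polynomial, natDegree_add_C, hmain]
  have hlc : (S.polynomial p).leadingCoeff = A * C B.leadingCoeff := by
    rw [leadingCoeff, hdeg, polynomial, coeff_add, coeff_C_mul, coeff_map,
      coeff_C_of_ne_zero hBpos.ne', add_zero]
    rfl
  have hc0 : (S.polynomial p).coeff 0 = C S.c := by
    have : B.coeff 0 = 0 := by
      rw [coeff_zero_eq_eval_zero]; exact eval_zero_linearized p hp _ _
    rw [polynomial, coeff_add, coeff_C_mul, coeff_map, this]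
    simp
  have hF0 : S.polynomial p ≠ 0 := fun h => by rw [h] at hdeg; simp at hdeg; omega
  have hred : (S.polynomial p).map (evalRingHom 0) = C S.c := by
    rw [polynomial, Polynomial.map_add, Polynomial.map_mul, map_C, map_C]
    simp [eval_zero_linearized p hp]
  have hcu : IsUnit (C S.c : k[X]) := isUnit_C.2 S.c_ne.isUnit
  have key : ∀ G H : k[X][X], S.polynomial p = G * H → H.leadingCoeff.eval 0 ≠ 0 →
      IsUnit H := by
    intro G H hGH hH
    have h1 : (G.map (evalRingHom 0)) * (H.map (evalRingHom 0)) = C S.c := by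
      rw [← Polynomial.map_mul, ← hGH, hred]
    have h2 : IsUnit (H.map (evalRingHom (0 : k))) := by
      refine isUnit_of_mul_isUnit_right (x := G.map (evalRingHom 0)) ?_
      rw [h1]; exact isUnit_C.2 S.c_ne.isUnit
    have h3 : H.natDegree = 0 := by
      rw [← natDegree_map_of_leadingCoeff_ne_zero (evalRingHom (0 : k)) (by simpa using hH)]
      exact natDegree_eq_zero_of_isUnit h2
    rw [eq_C_of_natDegree_eq_zero h3] at hGH ⊢
    rw [isUnit_C]
    refine isUnit_of_mul_isUnit_right (x := G.coeff 0) ?_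
    rw [← coeff_mul_C, ← hGH, hc0]
    exact hcu
  refine ⟨fun h => ?_, fun G H hGH => ?_⟩
  · have := natDegree_eq_zero_of_isUnit h
    omega
  · by_cases hH : H.leadingCoeff.eval 0 = 0
    · left
      refine key H G (by rw [hGH, mul_comm]) fun hG => ?_
      obtain ⟨g, hg⟩ : X ∣ G.leadingCoeff := by
        rw [X_dvd_iff, coeff_zero_eq_eval_zero, hG]
      obtain ⟨h, hh⟩ : X ∣ H.leadingCoeff := by
        rw [X_dvd_iff, coeff_zero_eq_eval_zero, hH]
      have h1 : A * C B.leadingCoeff = X * (X * (g * h)) := by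
        rw [← hlc, hGH, leadingCoeff_mul, hg, hh]; ring
      have h2 := congrArg (fun f => coeff f 1) h1
      simp only [coeff_mul_C, coeff_X_mul, coeff_X_mul_zero, hA] at h2
      rw [coeff_one_linearized p hp] at h2
      exact (mul_ne_zero S.α₁_zero_ne (leadingCoeff_ne_zero.2 hB0)) h2
    · right
      exact key G H hGH hH

/-- The coordinate ring `k[x, y] / (L₁(x) L₂(y) + c)` of the affine plane curve. -/
abbrev CoordinateRing : Type u := AdjoinRoot (S.polynomial p)

instance instIsDomainCoordinateRing [hp : Fact p.Prime] : IsDomain (S.CoordinateRing p) :=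
  AdjoinRoot.isDomain_of_prime (S.irreducible_polynomial p hp.out).prime

/-- The function field `k(C) = k(x, y)` of the plane curve `C : L₁(x) L₂(y) + c = 0`. -/
abbrev FunctionField : Type u := FractionRing (S.CoordinateRing p)

/-- The coordinate function `x`. -/
def x : S.FunctionField p :=
  algebraMap (S.CoordinateRing p) (S.FunctionField p) (AdjoinRoot.of (S.polynomial p) X)

/-- The coordinate function `y`. -/
def y : S.FunctionField p :=
  algebraMap (S.CoordinateRing p) (S.FunctionField p) (AdjoinRoot.root (S.polynomial p))

variable [Fact p.Prime]

/-- The smooth projective model `X` of the plane curve `C`: the set of all discrete valuation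
rings of its function field over `k`. -/
abbrev Curve : Type u := AlgCurve.Place k (S.FunctionField p)

/-- The divisor `D` on `X` given by the line `Z = 0` of the plane model, i.e. cut out by the line
`Z = 0` of `ℙ²` under the map `(x : y : 1)`. -/
def lineDivisor : S.Curve p → ℤ :=
  AlgCurve.hyperplaneDivisor ![S.x p, S.y p, 1] ![(0 : k), 0, 1]

end GenASM

end

open scoped LinearAlgebra.Projectivization WithZero

/-! Write q = p^e. Everything rests on local equations at the points of the curve. If x and y take
finite values a, b at a place, then L₁(a)L₂(b) = -c ≠ 0. Since L₁ and L₂ are additive with nonzero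
linear coefficient, the equation shifted to (a, b) expresses y - b as a multiple of x - a, so x - a
is a uniformizer (`affine_chart`). If x has a pole, the equation reads N·L₂(y) = -c·x^{-q} with N a
unit. Hence y takes as value a root β of L₂, x⁻¹ is a uniformizer, and y - β vanishes to order q
(`pole_chart`). The roles of x and y can be exchanged. So x and y have simple poles, at disjoint
sets of places.

Embedding: each valuation ring of K/k other than K is the local ring of a point in an affine chart
with coordinates fᵢ/fⱼ, where f = (x, y, 1, xy) (`exists_chart`, `HasCharts`). The coordinate xy is
what makes this work at infinity: it supplies y = xy/x at the poles of x, which (x : y : 1) sends to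
a single point, and likewise x = xy/y at the poles of y. For any f with such charts, the local ring
at P is the ring of ratios of forms in f with denominator nonzero at φ(P). This gives injectivity
and the comparison of regular functions. Domination by valuation rings shows that the image is the
zero locus of all forms vanishing on f, hence closed (`HasCharts.isEmbedding`).

Riemann–Roch space: D(P) is the maximum of 0 and the pole orders of x and y at P, and xy has no
worse poles, so 1, x, y, xy lie in L(D). Conversely, let f be in L(D) and write d(x)f = ∑ nᵢ(x)yⁱ
with i < q. Evaluating on the q places above each root of d, or at the pole of y lying there, allows
the roots of d to be cancelled one by one. The q poles of x then force deg nᵢ ≤ 1, and the q poles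
of y force nᵢ = 0 for i ≥ 2 (`mem_span`). Completeness follows, because the plane with coefficients
a cuts out D + div(∑ aᵢfᵢ). -/

/-! ### Discrete valuation rings from two generators of the field -/

theorem ValuationSubring.ne_top_of_valuation_lt_one {K : Type*} [Field K] {V : ValuationSubring K}
    {z : K} (hz : z ≠ 0) (h : V.valuation z < 1) : V ≠ ⊤ := by
  rintro rfl
  have := mul_lt_one_of_lt_of_le h
    (((⊤ : ValuationSubring K).valuation_le_one_iff z⁻¹).2 trivial)
  rw [← map_mul, mul_inv_cancel₀ hz] at this
  simp at this

/-- The Jacobian criterion in algebraic form. Let B be the localization of k[u, w] at the center of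
V. The relation hw = ug with h a unit makes u generate the maximal ideal of B, so the Noetherian
local domain B is a discrete valuation ring. It has fraction field K and is dominated by V, so it
equals V. -/
theorem ValuationSubring.isDiscreteValuationRing_of_generators {k K : Type*} [Field k] [Field K]
    [Algebra k K] (V : ValuationSubring K) (hk : ∀ a : k, algebraMap k K a ∈ V) (hV : V ≠ ⊤)
    {u w : K} (hu : V.valuation u < 1) (hw : V.valuation w < 1)
    (hgen : IntermediateField.adjoin k {u, w} = ⊤)
    (hrel : ∃ g ∈ Algebra.adjoin k {u, w}, ∃ h ∈ Algebra.adjoin k {u, w},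
      V.valuation h = 1 ∧ h * w = u * g) :
    IsDiscreteValuationRing V ∧ (∀ f, V.valuation f < 1 → ∃ g ∈ V, f = u * g) ∧
      ∀ f ∈ V, ∃ a ∈ Algebra.adjoin k {u, w}, ∃ b ∈ Algebra.adjoin k {u, w},
        V.valuation b = 1 ∧ f = a / b := by
  have huV : u ∈ V := (V.valuation_le_one_iff u).1 hu.le
  have hwV : w ∈ V := (V.valuation_le_one_iff w).1 hw.le
  have hAV : ∀ a ∈ Algebra.adjoin k {u, w}, a ∈ V := by
    intro a ha
    induction ha using Algebra.adjoin_induction with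
    | mem z hz => rcases hz with rfl | rfl <;> assumption
    | algebraMap r => exact hk r
    | add a b _ _ h1 h2 => exact V.add_mem _ _ h1 h2
    | mul a b _ _ h1 h2 => exact V.mul_mem _ _ h1 h2
  have hFG : IsNoetherianRing (Algebra.adjoin k {u, w}) :=
    isNoetherianRing_of_fg (Subalgebra.fg_def.2 ⟨{u, w}, Set.toFinite _, rfl⟩)
  set A : Subring K := (Algebra.adjoin k {u, w}).toSubring with hA
  have hAN : IsNoetherianRing A := hFG
  have hAV' : A ≤ V.toSubring := hAV
  let P : Ideal A := (IsLocalRing.maximalIdeal V).comap (Subring.inclusion hAV')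
  have hP : ∀ a : A, a ∈ P ↔ V.valuation a < 1 := fun a =>
    V.valuation_lt_one_iff (Subring.inclusion hAV' a)
  have hP1 : ∀ a : A, a ∉ P ↔ V.valuation a = 1 := fun a => by
    rw [hP, not_lt]
    exact ⟨fun h => le_antisymm ((V.valuation_le_one_iff _).2 (hAV' a.2)) h, fun h => h.ge⟩
  have : P.IsPrime := inferInstanceAs (Ideal.IsPrime (Ideal.comap _ _))
  let B := (LocalSubring.ofPrime A P).toSubring
  have hB1 : ∀ z ∈ B, ∃ a ∈ A, ∃ b ∈ A, V.valuation b = 1 ∧ z = a / b := by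
    intro z hz
    obtain ⟨⟨a, s⟩, hs⟩ := IsLocalization.surj P.primeCompl (⟨z, hz⟩ : B)
    have hs' : z * (s : A) = (a : K) := congrArg Subtype.val hs
    have h1 : V.valuation (s : A) = 1 := (hP1 _).1 s.2
    refine ⟨a, a.2, s, s.1.2, h1, ?_⟩
    rw [← hs', mul_div_cancel_right₀]
    intro h0
    rw [h0] at h1
    simp at h1
  have hAB : A ≤ B := LocalSubring.le_ofPrime A P
  have hB2 : ∀ a ∈ A, ∀ b ∈ A, V.valuation b = 1 → a / b ∈ B := by
    intro a ha b hb h1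
    have hbP : (⟨b, hb⟩ : A) ∈ P.primeCompl := (hP1 ⟨b, hb⟩).2 h1
    obtain ⟨c, hc⟩ := (IsLocalization.map_units B (⟨_, hbP⟩ : P.primeCompl)).exists_right_inv
    have hc' : b * (c : K) = 1 := congrArg Subtype.val hc
    rw [div_eq_mul_inv, ← eq_inv_of_mul_eq_one_right hc']
    exact B.mul_mem (hAB ha) c.2
  have hBV : ∀ z ∈ B, z ∈ V := by
    intro z hz
    obtain ⟨a, ha, b, hb, h1, rfl⟩ := hB1 z hz
    rw [← V.valuation_le_one_iff, map_div₀, h1, div_one, V.valuation_le_one_iff]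
    exact hAV a ha
  have hBinv : ∀ z ∈ B, V.valuation z = 1 → z⁻¹ ∈ B := by
    intro z hz h
    obtain ⟨a, ha, b, hb, h1, rfl⟩ := hB1 z hz
    rw [map_div₀, h1, div_one] at h
    rw [inv_div]
    exact hB2 b hb a ha h
  have huA : u ∈ A := Algebra.subset_adjoin (by simp)
  -- Modulo uB every polynomial in u and w is a constant, because w = u(g/h) with g/h in B.
  have hexp : ∀ a ∈ Algebra.adjoin k {u, w}, ∃ c : k, ∃ z ∈ B, a = algebraMap k K c + u * z := by
    have hcB : ∀ c : k, algebraMap k K c ∈ B := fun c => hAB (Subalgebra.algebraMap_mem _ c)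
    intro a ha
    induction ha using Algebra.adjoin_induction with
    | mem z hz =>
      rcases hz with rfl | rfl
      · exact ⟨0, 1, B.one_mem, by simp⟩
      · obtain ⟨g, hg, h, hh, h1, h2⟩ := hrel
        have h0 : h ≠ 0 := by rintro rfl; simp at h1
        refine ⟨0, g / h, hB2 g hg h hh h1, ?_⟩
        rw [map_zero, zero_add]
        field_simp
        linear_combination h2
    | algebraMap r => exact ⟨r, 0, B.zero_mem, by simp⟩
    | add a b _ _ h1 h2 =>
      obtain ⟨c, z, hz, rfl⟩ := h1
      obtain ⟨c', z', hz', rfl⟩ := h2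
      exact ⟨c + c', z + z', B.add_mem hz hz', by rw [map_add]; ring⟩
    | mul a b _ _ h1 h2 =>
      obtain ⟨c, z, hz, rfl⟩ := h1
      obtain ⟨c', z', hz', rfl⟩ := h2
      refine ⟨c * c', algebraMap k K c * z' + algebraMap k K c' * z + u * (z * z'), ?_, ?_⟩
      · exact B.add_mem (B.add_mem (B.mul_mem (hcB _) hz') (B.mul_mem (hcB _) hz))
          (B.mul_mem (hAB huA) (B.mul_mem hz hz'))
      · rw [map_mul]; ring
  have hmax : ∀ z ∈ B, V.valuation z < 1 → ∃ z' ∈ B, z = u * z' := by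
    intro z hz h
    obtain ⟨a, ha, b, hb, h1, rfl⟩ := hB1 z hz
    rw [map_div₀, h1, div_one] at h
    obtain ⟨c, y, hy, rfl⟩ := hexp a ha
    have hc : c = 0 := by
      by_contra hc
      have h2 : V.valuation (u * y) < 1 := by
        rw [map_mul]
        exact mul_lt_one_of_lt_of_le hu ((V.valuation_le_one_iff _).2 (hBV y hy))
      have h3 : V.valuation (algebraMap k K c) < 1 := by
        have := Valuation.map_sub_lt _ h h2
        rwa [add_sub_cancel_right] at this
      have h4 : V.valuation (algebraMap k K c⁻¹) ≤ 1 := (V.valuation_le_one_iff _).2 (hk _)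
      have h5 := mul_lt_one_of_lt_of_le h3 h4
      rw [← map_mul, ← map_mul, mul_inv_cancel₀ hc] at h5
      simp at h5
    subst hc
    refine ⟨y * (1 / b), B.mul_mem hy (hB2 1 A.one_mem b hb h1), by rw [map_zero]; ring⟩
  have : IsNoetherianRing B := IsLocalization.isNoetherianRing P.primeCompl B hAN
  have hBu : ∀ z : B, V.valuation (z : K) = 1 → IsUnit z := by
    intro z hz
    have h0 : (z : K) ≠ 0 := by intro h; rw [h] at hz; simp at hz
    exact IsUnit.of_mul_eq_one ⟨_, hBinv z z.2 hz⟩ (Subtype.ext (mul_inv_cancel₀ h0))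
  have hmaxB : IsLocalRing.maximalIdeal B = Ideal.span {(⟨u, hAB huA⟩ : B)} := by
    apply le_antisymm
    · intro z hz
      have : V.valuation (z : K) < 1 := by
        refine lt_of_le_of_ne ((V.valuation_le_one_iff _).2 (hBV z z.2)) fun h => ?_
        exact hz (hBu z h)
      obtain ⟨z', hz', h⟩ := hmax z z.2 this
      rw [Ideal.mem_span_singleton]
      exact ⟨⟨z', hz'⟩, Subtype.ext h⟩
    · rw [Ideal.span_le, Set.singleton_subset_iff]
      intro h
      obtain ⟨c, hc⟩ := h.exists_right_inv
      have hc' : u * (c : K) = 1 := congrArg Subtype.val hc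
      have := mul_lt_one_of_lt_of_le hu ((V.valuation_le_one_iff _).2 (hBV c c.2))
      rw [← map_mul, hc'] at this
      simp at this
  have hfrac : ∀ f : K, ∃ a ∈ A, ∃ b ∈ A, f = a / b := by
    intro f
    have : f ∈ IntermediateField.adjoin k {u, w} := by rw [hgen]; trivial
    exact IntermediateField.mem_adjoin_iff_div.1 this
  have hVR : ValuationRing B :=
    ((tfae_of_isNoetherianRing_of_isLocalRing_of_isDomain B).out 4 1 rfl rfl).1 ⟨_, hmaxB⟩
  -- A valuation ring is maximal for domination: if a/b lies in V but b is the multiple of a, the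
  -- cofactor is a unit of V, hence of B.
  have hVB : ∀ f ∈ V, f ∈ B := by
    intro f hf
    obtain ⟨a, ha, b, hb, rfl⟩ := hfrac f
    by_cases hb0 : b = 0
    · simp [hb0]
    by_cases ha0 : a = 0
    · simp [ha0]
    obtain ⟨c, hc⟩ := ValuationRing.cond (⟨a, hAB ha⟩ : B) ⟨b, hAB hb⟩
    rcases hc with hc | hc
    · have hc' : a * (c : K) = b := congrArg Subtype.val hc
      have hab : a / b = (c : K)⁻¹ := by
        rw [← hc', div_mul_cancel_left₀ ha0]
      rw [hab] at hf ⊢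
      apply hBinv _ c.2
      apply le_antisymm ((V.valuation_le_one_iff _).2 (hBV c c.2))
      have := (V.valuation_le_one_iff _).2 hf
      rw [map_inv₀] at this
      refine (inv_le_one₀ ?_).1 this
      rw [zero_lt_iff, ne_eq, map_eq_zero]
      rintro h
      rw [h] at hc'
      simp at hc'
      exact hb0 hc'.symm
    · have hc' : b * (c : K) = a := congrArg Subtype.val hc
      rw [← hc', mul_div_cancel_left₀ _ hb0]
      exact c.2
  have hEq : V.toSubring = B := le_antisymm hVB hBV
  have hnf : ¬ IsField B := by
    intro hF
    refine hV (top_unique ?_)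
    intro f _
    obtain ⟨a, ha, b, hb, rfl⟩ := hfrac f
    by_cases hb0 : b = 0
    · simp [hb0]
    obtain ⟨c, hc⟩ := hF.mul_inv_cancel (a := (⟨b, hAB hb⟩ : B))
      (fun h => hb0 (congrArg Subtype.val h))
    have hc' : b * (c : K) = 1 := congrArg Subtype.val hc
    rw [div_eq_mul_inv, ← eq_inv_of_mul_eq_one_right hc']
    exact hBV _ (B.mul_mem (hAB ha) c.2)
  have hDB : IsDiscreteValuationRing B :=
    ((IsDiscreteValuationRing.TFAE B hnf).out 4 0 rfl rfl).1 ⟨_, hmaxB⟩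
  refine ⟨?_, ?_, ?_⟩
  · exact IsDiscreteValuationRing.RingEquivClass.isDiscreteValuationRing
      (RingEquiv.subringCongr hEq.symm)
  · intro f hf
    obtain ⟨z, hz, h⟩ := hmax f (hVB f ((V.valuation_le_one_iff _).1 hf.le)) hf
    exact ⟨z, hBV z hz, h⟩
  · intro f hf
    exact hB1 f (hVB f hf)

open Polynomial

/-! ### Valuations that are trivial on the constant field -/

section ConstantField

variable {k K Γ₀ : Type*} [Field k] [Field K] [Algebra k K] [LinearOrderedCommGroupWithZero Γ₀]
  {v : Valuation K Γ₀}

theorem Valuation.algebraMap_eq_one_of_le_one (hv : ∀ a : k, v (algebraMap k K a) ≤ 1) {a : k}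
    (ha : a ≠ 0) : v (algebraMap k K a) = 1 := by
  apply le_antisymm (hv a)
  have := hv a⁻¹
  rw [map_inv₀, map_inv₀] at this
  exact (inv_le_one₀ (by simpa [zero_lt_iff] using ha)).1 this

theorem Valuation.eq_zero_of_algebraMap_lt_one (hv : ∀ a : k, v (algebraMap k K a) ≤ 1) {a : k}
    (ha : v (algebraMap k K a) < 1) : a = 0 := by
  by_contra h
  exact ha.ne (Valuation.algebraMap_eq_one_of_le_one hv h)

theorem Valuation.le_one_of_sub_lt_one (hv : ∀ a : k, v (algebraMap k K a) ≤ 1) {τ : K} {a : k}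
    (h : v (τ - algebraMap k K a) < 1) : v τ ≤ 1 := by
  rw [← sub_add_cancel τ (algebraMap k K a)]
  exact (v.map_add _ _).trans (max_le h.le (hv a))

theorem Valuation.eq_of_sub_lt_one (hv : ∀ a : k, v (algebraMap k K a) ≤ 1) {τ : K} {a b : k}
    (ha : v (τ - algebraMap k K a) < 1) (hb : v (τ - algebraMap k K b) < 1) : a = b := by
  have := v.map_sub_lt ha hb
  rw [sub_sub_sub_cancel_left, ← _root_.map_sub] at this
  exact (sub_eq_zero.1 (Valuation.eq_zero_of_algebraMap_lt_one hv this)).symm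

theorem Valuation.mul_sub_mul_lt_one (hv : ∀ a : k, v (algebraMap k K a) ≤ 1) {s t : K} {a b : k}
    (hs : v (s - algebraMap k K a) < 1) (ht : v (t - algebraMap k K b) < 1) :
    v (s * t - algebraMap k K (a * b)) < 1 := by
  have e : s * t - algebraMap k K (a * b) = (s - algebraMap k K a) * t
      + (t - algebraMap k K b) * algebraMap k K a := by
    rw [map_mul]; ring
  rw [e]
  refine v.map_add_lt ?_ ?_
  · rw [map_mul]; exact mul_lt_one_of_lt_of_le hs (Valuation.le_one_of_sub_lt_one hv ht)
  · rw [map_mul]; exact mul_lt_one_of_lt_of_le ht (hv a)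

theorem Valuation.add_sub_add_lt_one {s t : K} {a b : k}
    (hs : v (s - algebraMap k K a) < 1) (ht : v (t - algebraMap k K b) < 1) :
    v (s + t - algebraMap k K (a + b)) < 1 := by
  rw [map_add, add_sub_add_comm]
  exact v.map_add_lt hs ht

theorem Valuation.aeval_le_one (hv : ∀ a : k, v (algebraMap k K a) ≤ 1) {τ : K} (hτ : v τ ≤ 1)
    (G : k[X]) : v (aeval τ G) ≤ 1 := by
  induction G using Polynomial.induction_on' with
  | add f g hf hg => rw [map_add]; exact (v.map_add _ _).trans (max_le hf hg)
  | monomial n a =>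
    rw [aeval_monomial, map_mul, map_pow]
    exact mul_le_one' (hv a) (pow_le_one' hτ n)

theorem Valuation.aeval_sub_eval_lt_one (hv : ∀ a : k, v (algebraMap k K a) ≤ 1) {τ : K} {a : k}
    (h : v (τ - algebraMap k K a) < 1) (G : k[X]) :
    v (aeval τ G - algebraMap k K (G.eval a)) < 1 := by
  obtain ⟨H, hH⟩ := X_sub_C_dvd_sub_C_eval (a := a) (p := G)
  have : aeval τ G - algebraMap k K (G.eval a) = (τ - algebraMap k K a) * aeval τ H := by
    have := congrArg (aeval τ) hH
    simpa using this
  rw [this, map_mul]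
  exact mul_lt_one_of_lt_of_le h
    (Valuation.aeval_le_one hv (Valuation.le_one_of_sub_lt_one hv h) H)

theorem Valuation.aeval_eq_one (hv : ∀ a : k, v (algebraMap k K a) ≤ 1) {τ : K} {a : k}
    (h : v (τ - algebraMap k K a) < 1) {G : k[X]} (hG : G.eval a ≠ 0) : v (aeval τ G) = 1 := by
  have h1 := Valuation.aeval_sub_eval_lt_one hv h G
  have h2 := Valuation.algebraMap_eq_one_of_le_one hv hG
  have := Valuation.map_add_eq_of_lt_right v (h1.trans_eq h2.symm)
  rwa [sub_add_cancel, h2] at this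

theorem Polynomial.aeval_eq_pow_mul_aeval_inv_reverse {τ : K} (hτ : τ ≠ 0) (G : k[X]) :
    aeval τ G = τ ^ G.natDegree * aeval τ⁻¹ G.reverse := by
  let _ := invertibleOfNonzero hτ
  have := eval₂_reverse_mul_pow (algebraMap k K) τ G
  rw [invOf_eq_inv] at this
  rw [mul_comm]
  exact this.symm

theorem Polynomial.eval_zero_reverse_ne_zero {G : k[X]} (hG : G ≠ 0) :
    G.reverse.eval 0 ≠ 0 := by
  rw [← coeff_zero_eq_eval_zero, coeff_zero_reverse]
  exact leadingCoeff_ne_zero.2 hG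

/-- At a pole of τ, the reversed polynomial is evaluated at τ⁻¹, which has value 0, and its constant
term is the leading coefficient of G. -/
theorem Valuation.aeval_inv_reverse_eq_one (hv : ∀ a : k, v (algebraMap k K a) ≤ 1) {τ : K}
    (hτ : 1 < v τ) {G : k[X]} (hG : G ≠ 0) : v (aeval τ⁻¹ G.reverse) = 1 := by
  refine Valuation.aeval_eq_one hv (a := 0) ?_ (Polynomial.eval_zero_reverse_ne_zero hG)
  rw [map_zero, sub_zero, map_inv₀]
  exact inv_lt_one_of_one_lt₀ hτ

/-- Over an algebraically closed field G is a product of linear factors; if the product has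
valuation below 1, so does one of the factors. -/
theorem Valuation.exists_root_of_aeval_lt_one [IsAlgClosed k]
    (hv : ∀ a : k, v (algebraMap k K a) ≤ 1) {τ : K} {G : k[X]} (hG : G ≠ 0)
    (h : v (aeval τ G) < 1) : ∃ a : k, G.eval a = 0 ∧ v (τ - algebraMap k K a) < 1 := by
  induction hn : G.natDegree generalizing G with
  | zero =>
    rw [eq_C_of_natDegree_eq_zero hn] at h hG
    rw [aeval_C] at h
    rw [Valuation.eq_zero_of_algebraMap_lt_one hv h] at hG
    simp at hG
  | succ n ih =>
    obtain ⟨a, ha⟩ := IsAlgClosed.exists_root G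
      (by rw [degree_eq_natDegree hG, hn]; exact_mod_cast Nat.succ_ne_zero n)
    obtain ⟨H, rfl⟩ := dvd_iff_isRoot.2 ha
    by_cases h1 : v (τ - algebraMap k K a) < 1
    · exact ⟨a, ha, h1⟩
    have hH : H ≠ 0 := right_ne_zero_of_mul hG
    have hd : H.natDegree = n := by
      rw [natDegree_mul (X_sub_C_ne_zero a) hH, natDegree_X_sub_C] at hn
      omega
    rw [map_mul, map_mul, _root_.map_sub, aeval_X, aeval_C] at h
    have h2 : v (aeval τ H) < 1 := by
      refine lt_of_le_of_lt ?_ h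
      exact le_mul_of_one_le_left' (not_lt.1 h1)
    obtain ⟨b, hb, hb'⟩ := ih hH h2 hd
    exact ⟨b, by simp [hb], hb'⟩

end ConstantField

/-! ### Linearized polynomials and the abstract curve equation -/

namespace GenASM

section Linearized

variable {k : Type*} [Field k] {p : ℕ} [hp : Fact p.Prime]

theorem linearized_ne_zero {e : ℕ} {α : ℕ → k} (h0 : α 0 ≠ 0) : linearized p e α ≠ 0 := by
  intro h
  have := coeff_one_linearized p hp.out e α
  rw [h, coeff_zero] at this
  exact h0 this.symm

theorem aeval_linearized_add [CharP k p] {K : Type*} [Field K] [Algebra k K] (e : ℕ) (α : ℕ → k)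
    (s t : K) : aeval (s + t) (linearized p e α) =
      aeval s (linearized p e α) + aeval t (linearized p e α) := by
  have : CharP K p := charP_of_injective_algebraMap (algebraMap k K).injective p
  simp only [linearized, map_sum, map_mul, aeval_C, map_pow, aeval_X, add_pow_char_pow, mul_add,
    Finset.sum_add_distrib]

theorem aeval_linearized_sub_algebraMap [CharP k p] {K : Type*} [Field K] [Algebra k K] (e : ℕ)
    (α : ℕ → k) (s : K) (a : k) : aeval (s - algebraMap k K a) (linearized p e α) =
      aeval s (linearized p e α) - algebraMap k K ((linearized p e α).eval a) := by
  have := aeval_linearized_add (p := p) e α (s - algebraMap k K a) (algebraMap k K a)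
  rw [sub_add_cancel, aeval_algebraMap_apply, coe_aeval_eq_eval] at this
  rw [this, add_sub_cancel_right]

theorem exists_linearized_eq_X_mul (e : ℕ) (α : ℕ → k) :
    ∃ M : k[X], linearized p e α = X * M ∧ M.eval 0 = α 0 := by
  refine ⟨(linearized p e α).divX, ?_, ?_⟩
  · conv_lhs => rw [← X_mul_divX_add (linearized p e α)]
    rw [coeff_zero_eq_eval_zero, eval_zero_linearized p hp.out, C_0, add_zero]
  · rw [← coeff_zero_eq_eval_zero, coeff_divX, zero_add, coeff_one_linearized p hp.out]

omit hp in
theorem derivative_linearized [CharP k p] (e : ℕ) (α : ℕ → k) :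
    derivative (linearized p e α) = C (α 0) := by
  rw [linearized, derivative_sum, Finset.sum_range_succ']
  simp [derivative_X_pow]

/-- In characteristic p the derivative is the nonzero constant α 0, so the polynomial is separable.
-/
theorem card_roots_linearized_add_C [DecidableEq k] [IsAlgClosed k] [CharP k p] {e : ℕ} {α : ℕ → k}
    (h0 : α 0 ≠ 0) (he : α e ≠ 0) (d : k) :
    (linearized p e α + C d).roots.toFinset.card = p ^ e := by
  have hsep : (linearized p e α + C d).Separable := by
    rw [separable_def, derivative_add, derivative_linearized, derivative_C, add_zero]
    exact (isCoprime_one_right (x := linearized p e α + C d)).of_isCoprime_of_dvd_right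
      (isUnit_C.2 h0.isUnit).dvd
  rw [Multiset.toFinset_card_of_nodup (nodup_roots hsep),
    ← (IsAlgClosed.splits _).natDegree_eq_card_roots, natDegree_add_C,
    natDegree_linearized p hp.out e α he]

end Linearized

/-- Generators `x, y` of a function field with `L₁(x) L₂(y) + c = 0`, where `L₁, L₂` are the
linearized polynomials of degree `p ^ e` with coefficients `α₁`, `α₂`. -/
structure Generators {k K : Type*} [Field k] [Field K] [Algebra k K] (p e : ℕ) (α₁ α₂ : ℕ → k)
    (c : k) (x y : K) : Prop where
  e_pos : 0 < e
  α₁_zero_ne : α₁ 0 ≠ 0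
  α₁_e_ne : α₁ e ≠ 0
  α₂_zero_ne : α₂ 0 ≠ 0
  α₂_e_ne : α₂ e ≠ 0
  c_ne : c ≠ 0
  rel : aeval x (linearized p e α₁) * aeval y (linearized p e α₂) + algebraMap k K c = 0
  gen : IntermediateField.adjoin k {x, y} = ⊤
  transcendental : Transcendental k x

namespace Generators

variable {k K : Type*} [Field k] [Field K] [Algebra k K] {p e : ℕ} {α₁ α₂ : ℕ → k}
    {c : k} {x y : K} [hp : Fact p.Prime]

omit hp in
theorem aeval_left_ne_zero (S : Generators p e α₁ α₂ c x y) :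
    aeval x (linearized p e α₁) ≠ 0 := by
  intro h
  have := S.rel
  rw [h, zero_mul, zero_add] at this
  exact S.c_ne (by simpa using this)

/-- Lets every statement about x be reused for y, although the function field is built
asymmetrically. If y were algebraic it would be a constant b, and L₁(T)L₂(b) + c, whose value at 0
is c ≠ 0, would vanish at x. -/
theorem symm [IsAlgClosed k] (S : Generators p e α₁ α₂ c x y) :
    Generators p e α₂ α₁ c y x where
  e_pos := S.e_pos
  α₁_zero_ne := S.α₂_zero_ne
  α₁_e_ne := S.α₂_e_ne
  α₂_zero_ne := S.α₁_zero_ne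
  α₂_e_ne := S.α₁_e_ne
  c_ne := S.c_ne
  rel := by rw [mul_comm]; exact S.rel
  gen := by rw [Set.pair_comm]; exact S.gen
  transcendental := by
    intro h
    obtain ⟨b, rfl⟩ := minpoly.mem_range_of_degree_eq_one k y
      (IsAlgClosed.degree_eq_one_of_irreducible k (minpoly.irreducible h.isIntegral))
    refine S.transcendental ⟨linearized p e α₁ * C ((linearized p e α₂).eval b) + C c, ?_, ?_⟩
    · intro h0
      have := congrArg (eval 0) h0
      rw [eval_add, eval_mul, eval_zero_linearized p hp.out, eval_C, eval_C, zero_mul, zero_add,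
        eval_zero] at this
      exact S.c_ne this
    · have := S.rel
      rw [aeval_algebraMap_apply, coe_aeval_eq_eval] at this
      simpa using this

/-! ### Local rings at affine points and at poles -/

section Charts

variable [CharP k p] {V : ValuationSubring K}

omit hp [CharP k p] in
theorem eval_mul_eval {Γ₀ : Type*} [LinearOrderedCommGroupWithZero Γ₀] {v : Valuation K Γ₀}
    (S : Generators p e α₁ α₂ c x y)
    (hv : ∀ a : k, v (algebraMap k K a) ≤ 1) {a b : k} (ha : v (x - algebraMap k K a) < 1)
    (hb : v (y - algebraMap k K b) < 1) :
    (linearized p e α₁).eval a * (linearized p e α₂).eval b + c = 0 := by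
  have h := Valuation.mul_sub_mul_lt_one hv
    (Valuation.aeval_sub_eval_lt_one hv ha (linearized p e α₁))
    (Valuation.aeval_sub_eval_lt_one hv hb (linearized p e α₂))
  rw [eq_neg_of_add_eq_zero_left S.rel, ← map_neg, ← map_sub] at h
  have := Valuation.eq_zero_of_algebraMap_lt_one hv h
  linear_combination -this

/-- Smoothness of the affine curve: by additivity the equation shifted to (a, b) has linear term in
w = y - b with coefficient L₁(a)·α₂ 0, which is nonzero because L₁(a)L₂(b) = -c. -/
theorem affine_chart (S : Generators p e α₁ α₂ c x y) (hk : ∀ a : k, algebraMap k K a ∈ V)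
    (hV : V ≠ ⊤) {a b : k} (ha : V.valuation (x - algebraMap k K a) < 1)
    (hb : V.valuation (y - algebraMap k K b) < 1) :
    IsDiscreteValuationRing V ∧ ∀ f ∈ V, ∃ g ∈ Algebra.adjoin k {x, y},
      ∃ h ∈ Algebra.adjoin k {x, y}, V.valuation h = 1 ∧ f = g / h := by
  have hk' := fun r : k => (V.valuation_le_one_iff _).2 (hk r)
  set u := x - algebraMap k K a with hu
  set w := y - algebraMap k K b with hw
  have hab := S.eval_mul_eval hk' ha hb
  obtain ⟨M₁, hM₁, -⟩ := exists_linearized_eq_X_mul (p := p) e α₁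
  obtain ⟨M₂, hM₂, hM₂'⟩ := exists_linearized_eq_X_mul (p := p) e α₂
  have hx : aeval u (linearized p e α₁) = aeval x (linearized p e α₁)
    - algebraMap k K ((linearized p e α₁).eval a) := aeval_linearized_sub_algebraMap e α₁ x a
  have hy : aeval w (linearized p e α₂) = aeval y (linearized p e α₂)
    - algebraMap k K ((linearized p e α₂).eval b) := aeval_linearized_sub_algebraMap e α₂ y b
  set A := (linearized p e α₁).eval a with hA
  set B := (linearized p e α₂).eval b with hB
  have hA0 : A ≠ 0 := by
    intro h
    rw [h, zero_mul, zero_add] at hab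
    exact S.c_ne hab
  have hx' : aeval u (linearized p e α₁) = u * aeval u M₁ := by rw [hM₁]; simp
  have hy' : aeval w (linearized p e α₂) = w * aeval w M₂ := by rw [hM₂]; simp
  have huw : ({u, w} : Set K) ⊆ Algebra.adjoin k {x, y} := by
    rintro z (rfl | rfl)
    · exact sub_mem (Algebra.subset_adjoin (by simp)) (Subalgebra.algebraMap_mem _ _)
    · exact sub_mem (Algebra.subset_adjoin (by simp)) (Subalgebra.algebraMap_mem _ _)
  have hle : Algebra.adjoin k {u, w} ≤ Algebra.adjoin k {x, y} := Algebra.adjoin_le huw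
  have huA : u ∈ Algebra.adjoin k {u, w} := Algebra.subset_adjoin (by simp)
  have hwA : w ∈ Algebra.adjoin k {u, w} := Algebra.subset_adjoin (by simp)
  have hgen : IntermediateField.adjoin k {u, w} = ⊤ := by
    rw [eq_top_iff, ← S.gen, IntermediateField.adjoin_le_iff]
    rintro z (rfl | rfl)
    · rw [← sub_add_cancel z (algebraMap k K a)]
      exact add_mem (IntermediateField.subset_adjoin _ _ (Set.mem_insert _ _))
        (IntermediateField.algebraMap_mem _ _)
    · rw [← sub_add_cancel z (algebraMap k K b)]
      exact add_mem (IntermediateField.subset_adjoin _ _ (Set.mem_insert_of_mem _ rfl))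
        (IntermediateField.algebraMap_mem _ _)
  have hmem : ∀ {t : K} (M : k[X]), t ∈ Algebra.adjoin k {u, w} →
      aeval t M ∈ Algebra.adjoin k {u, w} := fun M ht =>
    Algebra.adjoin_le (Set.singleton_subset_iff.2 ht) (aeval_mem_adjoin_singleton k _)
  have hval : V.valuation (algebraMap k K A * aeval w M₂) = 1 := by
    rw [map_mul, Valuation.algebraMap_eq_one_of_le_one hk' hA0, one_mul]
    refine Valuation.aeval_eq_one hk' (a := 0) (by simpa using hb) ?_
    rw [hM₂']
    exact S.α₂_zero_ne
  -- Expand (A + L₁(u))(B + L₂(w)) + c = 0, cancel AB + c = 0, and factor L₁(u) = uM₁(u), L₂(w) =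
  -- wM₂(w).
  have hrel : algebraMap k K A * aeval w M₂ * w =
      u * -(aeval u M₁ * (aeval w (linearized p e α₂) + algebraMap k K B)) := by
    have hab' : algebraMap k K A * algebraMap k K B + algebraMap k K c = 0 := by
      rw [← map_mul, ← map_add, hab, map_zero]
    have hrel := S.rel
    linear_combination (-algebraMap k K A) * hy' - aeval y (linearized p e α₂) * hx' +
      u * aeval u M₁ * hy + algebraMap k K A * hy + aeval y (linearized p e α₂) * hx + hrel - hab'
  obtain ⟨h1, -, h3⟩ := V.isDiscreteValuationRing_of_generators hk hV ha hb hgen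
    ⟨_, neg_mem (mul_mem (hmem _ huA) (add_mem (hmem _ hwA) (Subalgebra.algebraMap_mem _ _))),
      _, mul_mem (Subalgebra.algebraMap_mem _ _) (hmem _ hwA), hval, hrel⟩
  refine ⟨h1, fun f hf => ?_⟩
  obtain ⟨g, hg, h, hh, hh'⟩ := h3 f hf
  exact ⟨g, hle hg, h, hle hh, hh'⟩

/-- With L₁(x) = x^q·N and N a unit, the equation becomes N·L₂(y) = -c·x^{-q}. So y is close to a
root β of L₂, and L₂(y) = L₂(y - β) is a unit times y - β. -/
theorem pole_chart [IsAlgClosed k] (S : Generators p e α₁ α₂ c x y)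
    (hk : ∀ a : k, algebraMap k K a ∈ V) (hx : 1 < V.valuation x) :
    ∃ β : k, (linearized p e α₂).eval β = 0 ∧
      V.valuation (y - algebraMap k K β) = V.valuation x⁻¹ ^ p ^ e ∧
      IsDiscreteValuationRing V ∧ (∀ f, V.valuation f < 1 → ∃ g ∈ V, f = x⁻¹ * g) ∧
      ∀ f ∈ V, ∃ g ∈ Algebra.adjoin k {x⁻¹, y},
        ∃ h ∈ Algebra.adjoin k {x⁻¹, y}, V.valuation h = 1 ∧ f = g / h := by
  have hk' := fun r : k => (V.valuation_le_one_iff _).2 (hk r)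
  have hL₁ := linearized_ne_zero (p := p) (e := e) S.α₁_zero_ne
  have hL₂ := linearized_ne_zero (p := p) (e := e) S.α₂_zero_ne
  have hx0 : x ≠ 0 := by rintro rfl; simp at hx
  have hV : V ≠ ⊤ := by
    rintro rfl
    exact not_le.2 hx ((ValuationSubring.valuation_le_one_iff _ _).2 trivial)
  have hq : p ^ e ≠ 0 := pow_ne_zero _ hp.out.ne_zero
  have hdeg := natDegree_linearized p hp.out e α₁ S.α₁_e_ne
  have hu1 : V.valuation x⁻¹ < 1 := by rw [map_inv₀]; exact inv_lt_one_of_one_lt₀ hx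
  have hN := Valuation.aeval_inv_reverse_eq_one hk' hx hL₁
  have hLx := Polynomial.aeval_eq_pow_mul_aeval_inv_reverse hx0 (linearized p e α₁)
  rw [hdeg] at hLx
  set N := aeval x⁻¹ (linearized p e α₁).reverse with hNdef
  have hrel : N * aeval y (linearized p e α₂) = - algebraMap k K c * x⁻¹ ^ p ^ e := by
    have := S.rel
    rw [hLx] at this
    rw [inv_pow]
    field_simp
    linear_combination this
  have hval : V.valuation (aeval y (linearized p e α₂)) = V.valuation x⁻¹ ^ p ^ e := by
    have := congrArg V.valuation hrel
    rwa [map_mul, map_mul, hN, one_mul, Valuation.map_neg,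
      Valuation.algebraMap_eq_one_of_le_one hk' S.c_ne, one_mul, map_pow] at this
  obtain ⟨β, hβ, hw⟩ := Valuation.exists_root_of_aeval_lt_one hk' hL₂
    (hval.trans_lt (pow_lt_one₀ zero_le hu1 hq))
  refine ⟨β, hβ, ?_⟩
  obtain ⟨M, hM, hM'⟩ := exists_linearized_eq_X_mul (p := p) e α₂
  have hy := aeval_linearized_sub_algebraMap (p := p) e α₂ y β
  rw [hβ, map_zero, sub_zero] at hy
  set w := y - algebraMap k K β with hwdef
  have hM1 : V.valuation (aeval w M) = 1 :=
    Valuation.aeval_eq_one hk' (a := 0) (by simpa using hw) (by rw [hM']; exact S.α₂_zero_ne)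
  have hy' : aeval y (linearized p e α₂) = w * aeval w M := by rw [← hy, hM]; simp
  have hle : Algebra.adjoin k {x⁻¹, w} ≤ Algebra.adjoin k {x⁻¹, y} := by
    apply Algebra.adjoin_le
    rintro z (rfl | rfl)
    · exact Algebra.subset_adjoin (by simp)
    · exact sub_mem (Algebra.subset_adjoin (by simp)) (Subalgebra.algebraMap_mem _ _)
  have huA : x⁻¹ ∈ Algebra.adjoin k {x⁻¹, w} := Algebra.subset_adjoin (by simp)
  have hwA : w ∈ Algebra.adjoin k {x⁻¹, w} := Algebra.subset_adjoin (by simp)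
  have hmem : ∀ {t : K} (M : k[X]), t ∈ Algebra.adjoin k {x⁻¹, w} →
      aeval t M ∈ Algebra.adjoin k {x⁻¹, w} := fun M ht =>
    Algebra.adjoin_le (Set.singleton_subset_iff.2 ht) (aeval_mem_adjoin_singleton k _)
  have hgen : IntermediateField.adjoin k {x⁻¹, w} = ⊤ := by
    rw [eq_top_iff, ← S.gen, IntermediateField.adjoin_le_iff]
    rintro z (rfl | rfl)
    · rw [← inv_inv z]
      exact inv_mem (IntermediateField.subset_adjoin _ _ (by simp))
    · rw [← sub_add_cancel z (algebraMap k K β)]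
      exact add_mem (IntermediateField.subset_adjoin _ _ (Set.mem_insert_of_mem _ rfl))
        (IntermediateField.algebraMap_mem _ _)
  have hrel' : N * aeval w M * w = x⁻¹ * (- algebraMap k K c * x⁻¹ ^ (p ^ e - 1)) := by
    have : x⁻¹ ^ p ^ e = x⁻¹ * x⁻¹ ^ (p ^ e - 1) := by
      rw [← pow_succ', Nat.sub_add_cancel (Nat.one_le_iff_ne_zero.2 hq)]
    rw [hy', this] at hrel
    linear_combination hrel
  obtain ⟨h1, h2, h3⟩ := V.isDiscreteValuationRing_of_generators hk hV hu1 hw hgen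
    ⟨_, mul_mem (neg_mem (Subalgebra.algebraMap_mem _ _)) (pow_mem huA _),
      N * aeval w M, mul_mem (hmem _ huA) (hmem _ hwA), by rw [map_mul, hN, hM1, one_mul], hrel'⟩
  refine ⟨?_, h1, h2, fun f hf => ?_⟩
  · rw [← hval, hy', map_mul, hM1, mul_one]
  · obtain ⟨g, hg, h, hh, hh'⟩ := h3 f hf
    exact ⟨g, hle hg, h, hle hh, hh'⟩

end Charts

end Generators

end GenASM

/-! ### Existence of valuation rings and classification of places -/

/-- Every place constructed below comes from this domination theorem, applied to the ring of
functions whose values are prescribed. -/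
theorem Subring.exists_valuationSubring_valuation_lt_one {K : Type*} [Field K] (A : Subring K)
    (I : Ideal A) (hI : I ≠ ⊤) :
    ∃ V : ValuationSubring K, A ≤ V.toSubring ∧ ∀ a ∈ I, V.valuation (a : K) < 1 := by
  obtain ⟨V, h1, h2⟩ := Ideal.image_subset_nonunits_valuationSubring I hI
  exact ⟨V, h1, fun a ha => V.mem_nonunits_iff.1 (h2 ⟨a, ha, rfl⟩)⟩

namespace GenASM.Generators

variable {k K : Type*} [Field k] [Field K] [Algebra k K] {p e : ℕ} {α₁ α₂ : ℕ → k}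
    {c : k} {x y : K} [hp : Fact p.Prime]

/-- The equation has degree q in y over k(x), so 1, y, …, y^{q-1} span K over k(x); then clear
denominators. -/
theorem exists_mul_eq_sum (S : Generators p e α₁ α₂ c x y) (f : K) :
    ∃ d : k[X], d ≠ 0 ∧ ∃ n : ℕ → k[X],
      aeval x d * f = ∑ i ∈ Finset.range (p ^ e), aeval x (n i) * y ^ i := by
  classical
  let E := IntermediateField.adjoin k {x}
  let A : E := ⟨aeval x (linearized p e α₁), by
    exact IntermediateField.algebra_adjoin_le_adjoin k _ (aeval_mem_adjoin_singleton k x)⟩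
  have hA : A ≠ 0 := fun h => S.aeval_left_ne_zero (congrArg Subtype.val h)
  let Q : E[X] := C A * (linearized p e α₂).map (algebraMap k E) + C (algebraMap k E c)
  have hQdeg : Q.natDegree = p ^ e := by
    rw [natDegree_add_C, natDegree_C_mul hA, natDegree_map,
      natDegree_linearized p hp.out e α₂ S.α₂_e_ne]
  have hQ0 : Q ≠ 0 := by
    intro h
    rw [h, natDegree_zero] at hQdeg
    exact pow_ne_zero _ hp.out.ne_zero hQdeg.symm
  have hQy : aeval y Q = 0 := by
    have h1 : algebraMap E K A = aeval x (linearized p e α₁) := rfl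
    rw [map_add, map_mul, aeval_C, aeval_C, h1, aeval_map_algebraMap,
      ← IsScalarTower.algebraMap_apply k E K]
    exact S.rel
  have hyint : IsIntegral E y := IsAlgebraic.isIntegral ⟨Q, hQ0, hQy⟩
  have htop : IntermediateField.adjoin E {y} = ⊤ := by
    rw [← IntermediateField.restrictScalars_eq_top_iff (K := k),
      IntermediateField.adjoin_simple_adjoin_simple]
    exact S.gen
  obtain ⟨G, hG⟩ : ∃ G : E[X], aeval y G = f := by
    have hf : f ∈ (IntermediateField.adjoin E {y}).toSubalgebra := by rw [htop]; trivial
    rw [IntermediateField.adjoin_simple_toSubalgebra_of_isAlgebraic hyint.isAlgebraic,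
      Algebra.adjoin_singleton_eq_range_aeval] at hf
    exact hf
  have hmon := minpoly.monic hyint
  have hdeg : (G %ₘ minpoly E y).natDegree < p ^ e := by
    refine (natDegree_modByMonic_lt G hmon (minpoly.ne_one E y)).trans_le ?_
    rw [← hQdeg]
    exact natDegree_le_of_dvd (minpoly.dvd E y hQy) hQ0
  have hG' : aeval y (G %ₘ minpoly E y) = f := by
    rw [← hG]
    conv_rhs => rw [← modByMonic_add_div G (minpoly E y)]
    simp
  set H := G %ₘ minpoly E y with hH
  have hc : ∀ i : ℕ, ∃ r s : k[X], s ≠ 0 ∧ aeval x s * (H.coeff i : K) = aeval x r := by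
    intro i
    obtain ⟨r, s, hrs⟩ := (IntermediateField.mem_adjoin_simple_iff k (α := x) _).1 (H.coeff i).2
    by_cases hs : aeval x s = 0
    · exact ⟨0, 1, one_ne_zero, by rw [hrs, hs]; simp⟩
    · exact ⟨r, s, by rintro rfl; simp at hs, by rw [hrs]; field_simp⟩
  choose r s hs hrs using hc
  refine ⟨∏ i ∈ Finset.range (p ^ e), s i, Finset.prod_ne_zero_iff.2 fun i _ => hs i,
    fun i => r i * ∏ j ∈ (Finset.range (p ^ e)).erase i, s j, ?_⟩
  rw [← hG', aeval_eq_sum_range' hdeg, Finset.mul_sum]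
  refine Finset.sum_congr rfl fun i hi => ?_
  rw [← Finset.mul_prod_erase _ _ hi, map_mul, map_mul, ← hrs, Algebra.smul_def]
  change _ * ((H.coeff i : K) * y ^ i) = _
  ring

section Places

variable [IsAlgClosed k] [CharP k p] {V : ValuationSubring K}

omit [CharP k p] in
-- If x had no value in k, every nonzero polynomial in x would be a unit of V. As x and y lie in V,
-- clearing denominators would put every function in V.
theorem exists_value_left (S : Generators p e α₁ α₂ c x y) (hk : ∀ a : k, algebraMap k K a ∈ V)
    (hV : V ≠ ⊤) (hx : V.valuation x ≤ 1) (hy : V.valuation y ≤ 1) :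
    ∃ a : k, V.valuation (x - algebraMap k K a) < 1 := by
  have hk' := fun r : k => (V.valuation_le_one_iff _).2 (hk r)
  by_contra! h
  refine hV (top_unique fun f _ => ?_)
  obtain ⟨d, hd, n, hn⟩ := S.exists_mul_eq_sum f
  have hd1 : V.valuation (aeval x d) = 1 := by
    refine le_antisymm (Valuation.aeval_le_one hk' hx d) (not_lt.1 fun hlt => ?_)
    obtain ⟨a, -, ha⟩ := Valuation.exists_root_of_aeval_lt_one hk' hd hlt
    exact not_le.2 ha (h a)
  rw [← V.valuation_le_one_iff, ← one_mul (V.valuation f)]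
  nth_rw 1 [← hd1]
  rw [← map_mul, hn]
  refine Valuation.map_sum_le _ fun i _ => ?_
  rw [map_mul, map_pow]
  exact mul_le_one' (Valuation.aeval_le_one hk' hx _) (pow_le_one' hy i)

omit [CharP k p] in
theorem exists_value_or_pole (S : Generators p e α₁ α₂ c x y)
    (hk : ∀ a : k, algebraMap k K a ∈ V) (hV : V ≠ ⊤) :
    (∃ a b : k, V.valuation (x - algebraMap k K a) < 1 ∧ V.valuation (y - algebraMap k K b) < 1) ∨
      1 < V.valuation x ∨ 1 < V.valuation y := by
  by_cases hx : 1 < V.valuation x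
  · exact Or.inr (Or.inl hx)
  by_cases hy : 1 < V.valuation y
  · exact Or.inr (Or.inr hy)
  obtain ⟨a, ha⟩ := S.exists_value_left hk hV (not_lt.1 hx) (not_lt.1 hy)
  obtain ⟨b, hb⟩ := S.symm.exists_value_left hk hV (not_lt.1 hy) (not_lt.1 hx)
  exact Or.inl ⟨a, b, ha, hb⟩

/-- The index j is 2 where x and y are finite, 0 at poles of x and 1 at poles of y. In the last two
charts the fourth coordinate xy supplies the missing generator, y or x. -/
theorem exists_chart (S : Generators p e α₁ α₂ c x y) (hk : ∀ a : k, algebraMap k K a ∈ V)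
    (hV : V ≠ ⊤) :
    IsDiscreteValuationRing V ∧ ∃ j : Fin 4, ![x, y, 1, x * y] j ≠ 0 ∧
      (∀ i, ∃ r : k, V.valuation (![x, y, 1, x * y] i / ![x, y, 1, x * y] j
        - algebraMap k K r) < 1) ∧
      ∀ f ∈ V, ∃ g ∈ Algebra.adjoin k
          (Set.range fun i => ![x, y, 1, x * y] i / ![x, y, 1, x * y] j),
        ∃ h ∈ Algebra.adjoin k (Set.range fun i => ![x, y, 1, x * y] i / ![x, y, 1, x * y] j),
          V.valuation h = 1 ∧ f = g / h := by
  have hk' := fun r : k => (V.valuation_le_one_iff _).2 (hk r)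
  have hq : p ^ e ≠ 0 := pow_ne_zero _ hp.out.ne_zero
  rcases S.exists_value_or_pole hk hV with ⟨a, b, ha, hb⟩ | hx | hy
  · obtain ⟨h1, h2⟩ := S.affine_chart hk hV ha hb
    refine ⟨h1, 2, by simp, fun i => ?_, fun f hf => ?_⟩
    · fin_cases i
      · exact ⟨a, by simpa using ha⟩
      · exact ⟨b, by simpa using hb⟩
      · exact ⟨1, by simp⟩
      · exact ⟨a * b, by simpa using Valuation.mul_sub_mul_lt_one hk' ha hb⟩
    · have hle : Algebra.adjoin k {x, y} ≤ Algebra.adjoin k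
          (Set.range fun i => ![x, y, 1, x * y] i / ![x, y, 1, x * y] 2) := by
        apply Algebra.adjoin_mono
        rintro z (rfl | rfl)
        · exact ⟨0, by simp⟩
        · exact ⟨1, by simp⟩
      obtain ⟨g, hg, h, hh, hh'⟩ := h2 f hf
      exact ⟨g, hle hg, h, hle hh, hh'⟩
  · obtain ⟨β, -, hw, h1, -, h2⟩ := S.pole_chart hk hx
    have hx0 : x ≠ 0 := by rintro rfl; simp at hx
    have hu1 : V.valuation x⁻¹ < 1 := by rw [map_inv₀]; exact inv_lt_one_of_one_lt₀ hx
    have hw1 : V.valuation (y - algebraMap k K β) < 1 := by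
      rw [hw]; exact pow_lt_one₀ zero_le hu1 hq
    refine ⟨h1, 0, by simpa using hx0, fun i => ?_, fun f hf => ?_⟩
    · fin_cases i
      · exact ⟨1, by simp [hx0]⟩
      · refine ⟨0, ?_⟩
        simpa [div_eq_mul_inv, mul_comm] using
          mul_lt_one_of_lt_of_le hu1 (Valuation.le_one_of_sub_lt_one hk' hw1)
      · exact ⟨0, by simpa using hu1⟩
      · exact ⟨β, by simpa [hx0] using hw1⟩
    · have hle : Algebra.adjoin k {x⁻¹, y} ≤ Algebra.adjoin k
          (Set.range fun i => ![x, y, 1, x * y] i / ![x, y, 1, x * y] 0) := by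
        apply Algebra.adjoin_mono
        rintro z (rfl | rfl)
        · exact ⟨2, by simp⟩
        · exact ⟨3, by simp [hx0]⟩
      obtain ⟨g, hg, h, hh, hh'⟩ := h2 f hf
      exact ⟨g, hle hg, h, hle hh, hh'⟩
  · obtain ⟨β, -, hw, h1, -, h2⟩ := S.symm.pole_chart hk hy
    have hy0 : y ≠ 0 := by rintro rfl; simp at hy
    have hu1 : V.valuation y⁻¹ < 1 := by rw [map_inv₀]; exact inv_lt_one_of_one_lt₀ hy
    have hw1 : V.valuation (x - algebraMap k K β) < 1 := by
      rw [hw]; exact pow_lt_one₀ zero_le hu1 hq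
    refine ⟨h1, 1, by simpa using hy0, fun i => ?_, fun f hf => ?_⟩
    · fin_cases i
      · refine ⟨0, ?_⟩
        simpa [div_eq_mul_inv, mul_comm] using
          mul_lt_one_of_lt_of_le hu1 (Valuation.le_one_of_sub_lt_one hk' hw1)
      · exact ⟨1, by simp [hy0]⟩
      · exact ⟨0, by simpa using hu1⟩
      · exact ⟨β, by simpa [hy0] using hw1⟩
    · have hle : Algebra.adjoin k {y⁻¹, x} ≤ Algebra.adjoin k
          (Set.range fun i => ![x, y, 1, x * y] i / ![x, y, 1, x * y] 1) := by
        apply Algebra.adjoin_mono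
        rintro z (rfl | rfl)
        · exact ⟨2, by simp⟩
        · exact ⟨3, by simp [hy0]⟩
      obtain ⟨g, hg, h, hh, hh'⟩ := h2 f hf
      exact ⟨g, hle hg, h, hle hh, hh'⟩

omit hp [IsAlgClosed k] [CharP k p] in
theorem exists_valuationSubring_value (S : Generators p e α₁ α₂ c x y) (a : k) :
    ∃ V : ValuationSubring K, (∀ r : k, algebraMap k K r ∈ V) ∧ V ≠ ⊤ ∧
      V.valuation (x - algebraMap k K a) < 1 := by
  have hmem : x - algebraMap k K a ∈ (Algebra.adjoin k {x}).toSubring :=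
    sub_mem (Algebra.subset_adjoin rfl) (Subalgebra.algebraMap_mem _ _)
  obtain ⟨V, h1, h2⟩ := Subring.exists_valuationSubring_valuation_lt_one
    (Algebra.adjoin k {x}).toSubring (Ideal.span {⟨_, hmem⟩}) (by
      intro h
      rw [Ideal.span_singleton_eq_top] at h
      obtain ⟨g, hg⟩ := h.exists_right_inv
      have hg' : (x - algebraMap k K a) * (g : K) = 1 := congrArg Subtype.val hg
      obtain ⟨G, hG⟩ : ∃ G : k[X], aeval x G = g :=
        (Algebra.adjoin_singleton_eq_range_aeval k x).le g.2
      have h0 : (X - C a) * G - 1 = 0 := by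
        apply (transcendental_iff.1 S.transcendental)
        simp [hG, hg']
      have := congrArg (eval a) h0
      simp at this)
  have h3 := h2 ⟨_, hmem⟩ (Ideal.mem_span_singleton_self _)
  refine ⟨V, fun r => h1 (Subalgebra.algebraMap_mem _ r),
    ValuationSubring.ne_top_of_valuation_lt_one (fun h => ?_) h3, h3⟩
  rw [sub_eq_zero] at h
  exact S.transcendental (h ▸ isAlgebraic_algebraMap a)

end Places

end GenASM.Generators

/-! ### The concrete function field -/

namespace GenASM

variable {k : Type*} [Field k] (S : GenASM k) (p : ℕ) [hp : Fact p.Prime]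

omit hp in
theorem aeval_x (G : k[X]) : aeval (S.x p) G =
    algebraMap (S.CoordinateRing p) (S.FunctionField p) (AdjoinRoot.of (S.polynomial p) G) := by
  rw [x, aeval_algebraMap_apply]
  congr 1
  have : AdjoinRoot.of (S.polynomial p) X = algebraMap k[X] (S.CoordinateRing p) X := rfl
  rw [this, aeval_algebraMap_apply, aeval_X_left_apply]
  rfl

theorem transcendental_x : Transcendental k (S.x p) := by
  have hdeg : (S.polynomial p).degree ≠ 0 := by
    intro h
    have h1 : (S.polynomial p).natDegree = 0 := natDegree_eq_of_degree_eq_some h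
    have hA : linearized p S.e S.α₁ ≠ 0 := linearized_ne_zero S.α₁_zero_ne
    rw [polynomial, natDegree_add_C, natDegree_C_mul hA,
      natDegree_map_eq_of_injective C_injective, natDegree_linearized p hp.out _ _ S.α₂_e_ne] at h1
    exact pow_ne_zero _ hp.out.ne_zero h1
  rw [transcendental_iff_injective]
  intro G H h
  change aeval (S.x p) G = aeval (S.x p) H at h
  rw [aeval_x, aeval_x] at h
  exact AdjoinRoot.of.injective_of_degree_ne_zero hdeg (IsFractionRing.injective _ _ h)

omit hp in
theorem eval₂_aeval_x (G : k[X][X]) :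
    eval₂ (aeval (S.x p)).toRingHom (S.y p) G =
      algebraMap (S.CoordinateRing p) (S.FunctionField p) (AdjoinRoot.mk (S.polynomial p) G) := by
  have h : (aeval (S.x p)).toRingHom = (algebraMap (S.CoordinateRing p) (S.FunctionField p)).comp
      (AdjoinRoot.of (S.polynomial p)) := RingHom.ext fun G => S.aeval_x p G
  rw [h, y, ← hom_eval₂]
  exact congrArg _ (AdjoinRoot.aeval_eq G)

theorem generators [IsAlgClosed k] :
    Generators p S.e S.α₁ S.α₂ S.c (S.x p) (S.y p) where
  e_pos := S.e_pos
  α₁_zero_ne := S.α₁_zero_ne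
  α₁_e_ne := S.α₁_e_ne
  α₂_zero_ne := S.α₂_zero_ne
  α₂_e_ne := S.α₂_e_ne
  c_ne := S.c_ne
  rel := by
    have h : eval₂ (aeval (S.x p)).toRingHom (S.y p)
        (C (linearized p S.e S.α₁) * (linearized p S.e S.α₂).map C + C (C S.c)) = 0 :=
      (S.eval₂_aeval_x p (S.polynomial p)).trans (by rw [AdjoinRoot.mk_self, map_zero])
    rw [eval₂_add, eval₂_mul, eval₂_C, eval₂_C,
      eval₂_map] at h
    have hC : (aeval (S.x p)).toRingHom.comp C = algebraMap k (S.FunctionField p) := by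
      ext r
      exact aeval_C _ _
    have hc : (aeval (S.x p)).toRingHom (C S.c) = algebraMap k _ S.c := aeval_C _ _
    rw [hC, hc] at h
    exact h
  gen := by
    rw [eq_top_iff]
    have hmem : ∀ z : S.CoordinateRing p, algebraMap (S.CoordinateRing p) (S.FunctionField p) z ∈
        IntermediateField.adjoin k {S.x p, S.y p} := by
      intro z
      obtain ⟨G, rfl⟩ := AdjoinRoot.mk_surjective z
      rw [← eval₂_aeval_x, eval₂_eq_sum]
      refine sum_mem fun i _ => mul_mem ?_ (pow_mem ?_ _)
      · refine IntermediateField.algebra_adjoin_le_adjoin k _ ?_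
        exact Algebra.adjoin_mono (by simp) (aeval_mem_adjoin_singleton k (S.x p))
      · exact IntermediateField.subset_adjoin _ _ (by simp)
    intro f _
    obtain ⟨r, s, -, rfl⟩ := IsFractionRing.div_surjective (S.CoordinateRing p) f
    exact div_mem (hmem r) (hmem s)
  transcendental := S.transcendental_x p

/-- Prescribing both values needs the presentation of the coordinate ring by the single equation:
evaluation at (a, b) descends to that quotient exactly because (a, b) lies on the curve. -/
theorem exists_valuationSubring_point {a b : k}
    (hab : (linearized p S.e S.α₁).eval a * (linearized p S.e S.α₂).eval b + S.c = 0) :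
    ∃ V : ValuationSubring (S.FunctionField p), (∀ r : k, algebraMap k _ r ∈ V) ∧
      V.valuation (S.x p - algebraMap k _ a) < 1 ∧ V.valuation (S.y p - algebraMap k _ b) < 1 := by
  let ev : S.CoordinateRing p →+* k := AdjoinRoot.lift (evalRingHom a) b (by
    have h : (evalRingHom a).comp C = RingHom.id k := by ext; simp
    rw [polynomial, eval₂_add, eval₂_mul, eval₂_C, eval₂_C, eval₂_map, h, ← hab]
    simp [eval₂_id])
  let ι := algebraMap (S.CoordinateRing p) (S.FunctionField p)
  -- The domination theorem concerns subrings of the field, so the coordinate ring is replaced by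
  -- its isomorphic image.
  let E : S.CoordinateRing p ≃+* ι.range := RingEquiv.ofBijective ι.rangeRestrict
    ⟨fun s t h => IsFractionRing.injective _ _ (congrArg Subtype.val h),
      ι.rangeRestrict_surjective⟩
  obtain ⟨V, h1, h2⟩ := Subring.exists_valuationSubring_valuation_lt_one ι.range
    (RingHom.ker (ev.comp (E.symm : ι.range →+* S.CoordinateRing p))) (RingHom.ker_ne_top _)
  have h3 : ∀ z : S.CoordinateRing p, ev z = 0 → V.valuation (ι z) < 1 := by
    intro z hz
    refine h2 (E z) ?_
    rw [RingHom.mem_ker]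
    simpa using hz
  have h4 : ∀ r : k, algebraMap k (S.FunctionField p) r =
      ι (AdjoinRoot.of (S.polynomial p) (C r)) := fun r => by
    rw [← S.aeval_x p, aeval_C]
  refine ⟨V, fun r => ?_, ?_, ?_⟩
  · rw [h4]
    exact h1 ⟨_, rfl⟩
  · rw [h4, x, ← map_sub]
    exact h3 _ (by simp [ev])
  · rw [h4, y, ← map_sub]
    exact h3 _ (by simp [ev])

end GenASM

/-! ### Homogeneous forms and homogenization -/

namespace MvPolynomial

variable {σ k K : Type*} [Field k] [Field K] [Algebra k K]

theorem IsHomogeneous.aeval_mul_left {F : MvPolynomial σ k} {d : ℕ} (hF : F.IsHomogeneous d)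
    (t : K) (g : σ → K) : MvPolynomial.aeval (fun i => t * g i) F =
      t ^ d * MvPolynomial.aeval g F := by
  rw [aeval_def, aeval_def, eval₂_eq, eval₂_eq, Finset.mul_sum]
  refine Finset.sum_congr rfl fun s hs => ?_
  simp only [mul_pow]
  rw [Finset.prod_mul_distrib, Finset.prod_pow_eq_pow_sum, hF.degree_eq_sum_deg_support hs]
  ring

/-- The homogenization of `H`, in degree `H.totalDegree`, by means of the variable `X j`. -/
noncomputable def homogenizeAt (H : MvPolynomial σ k) (j : σ) : MvPolynomial σ k :=
  ∑ m ∈ Finset.range (H.totalDegree + 1), homogeneousComponent m H * X j ^ (H.totalDegree - m)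

theorem isHomogeneous_homogenizeAt (H : MvPolynomial σ k) (j : σ) :
    (H.homogenizeAt j).IsHomogeneous H.totalDegree := by
  refine IsHomogeneous.sum _ _ _ fun m hm => ?_
  have := (homogeneousComponent_isHomogeneous m H).mul
    (isHomogeneous_X_pow (R := k) j (H.totalDegree - m))
  rwa [Nat.add_sub_cancel' (Nat.lt_succ_iff.1 (Finset.mem_range.1 hm))] at this

theorem aeval_homogenizeAt (H : MvPolynomial σ k) {j : σ} {g : σ → K} (hg : g j ≠ 0) :
    aeval g (H.homogenizeAt j) = g j ^ H.totalDegree * aeval (fun i => g i / g j) H := by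
  have hH : aeval (fun i => g i / g j) H = ∑ m ∈ Finset.range (H.totalDegree + 1),
      aeval (fun i => g i / g j) (homogeneousComponent m H) := by
    rw [← map_sum, sum_homogeneousComponent]
  rw [hH, homogenizeAt, map_sum, Finset.mul_sum]
  refine Finset.sum_congr rfl fun m hm => ?_
  have h1 : g = fun i => g j * (g i / g j) := by
    funext i
    field_simp
  have h2 := (homogeneousComponent_isHomogeneous m H).aeval_mul_left (g j) (fun i => g i / g j)
  rw [← h1] at h2
  have h3 : g j ^ H.totalDegree = g j ^ m * g j ^ (H.totalDegree - m) := by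
    rw [← pow_add, Nat.add_sub_cancel' (Nat.lt_succ_iff.1 (Finset.mem_range.1 hm))]
  rw [map_mul, map_pow, aeval_X, h2, h3]
  ring

end MvPolynomial

/-! ### Values at places, maps to projective space, ratios of forms -/

namespace AlgCurve

variable {k K : Type*} [Field k] [Field K] [Algebra k K]

theorem isOpen_place_iff {U : Set (Place k K)} : IsOpen U ↔ (U.Nonempty → Uᶜ.Finite) := Iff.rfl

namespace Place

variable (P : Place k K)

theorem val_algebraMap_le_one (a : k) : P.val (algebraMap k K a) ≤ 1 :=
  (P.val_le_one_iff _).2 (P.algebraMap_mem a)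

/-- Connects the normalized valuation of a place with the canonical valuation of its ring, in which
the charts are stated because they precede the proof of discreteness. -/
theorem isEquiv_valuation : P.val.IsEquiv P.ring.valuation :=
  Valuation.isEquiv_of_val_le_one fun f => by
    rw [P.val_le_one_iff, P.ring.valuation_le_one_iff]

theorem val_lt_one_iff (f : K) : P.val f < 1 ↔ P.ring.valuation f < 1 :=
  Valuation.isEquiv_iff_val_lt_one.1 P.isEquiv_valuation

theorem val_eq_one_iff (f : K) : P.val f = 1 ↔ P.ring.valuation f = 1 :=
  Valuation.isEquiv_iff_val_eq_one.1 P.isEquiv_valuation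

theorem one_lt_val_iff (f : K) : 1 < P.val f ↔ 1 < P.ring.valuation f := by
  rw [← not_le, ← not_le, P.val_le_one_iff, P.ring.valuation_le_one_iff]

theorem ring_ne_top : P.ring ≠ ⊤ := by
  have := P.isDVR
  obtain ⟨z, hz, hz0⟩ := Submodule.exists_mem_ne_zero_of_ne_bot
    (IsDiscreteValuationRing.not_a_field P.ring)
  exact ValuationSubring.ne_top_of_valuation_lt_one (z := (z : K)) (by simpa using hz0)
    ((P.ring.valuation_lt_one_iff z).1 hz)

theorem val_uniformizer {u : K} (hu : P.val u < 1)
    (h : ∀ f, P.ring.valuation f < 1 → ∃ g ∈ P.ring, f = u * g) :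
    P.val u = WithZero.exp (-1 : ℤ) := by
  have := P.isDVR
  have huP : u ∈ P.ring := (P.val_le_one_iff u).1 hu.le
  have hspan : (IsDiscreteValuationRing.maximalIdeal P.ring).asIdeal =
      Ideal.span {(⟨u, huP⟩ : P.ring)} := by
    apply le_antisymm
    · intro z hz
      obtain ⟨g, hg, h⟩ := h z ((P.ring.valuation_lt_one_iff z).1 hz)
      exact Ideal.mem_span_singleton.2 ⟨⟨g, hg⟩, Subtype.ext h⟩
    · rw [Ideal.span_le, Set.singleton_subset_iff]
      exact (P.ring.valuation_lt_one_iff _).2 ((P.val_lt_one_iff u).1 hu)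
  have hu0 : (⟨u, huP⟩ : P.ring) ≠ 0 := by
    intro h0
    rw [h0, Ideal.span_singleton_eq_bot.2 rfl] at hspan
    exact (IsDiscreteValuationRing.maximalIdeal P.ring).ne_bot hspan
  have h1 := (IsDiscreteValuationRing.maximalIdeal P.ring).valuation_of_algebraMap (K := K)
    (⟨u, huP⟩ : P.ring)
  rw [IsDedekindDomain.HeightOneSpectrum.intValuation_singleton _ hu0 hspan] at h1
  exact h1

variable {P}

theorem HasValue.val_le_one {f : K} {a : k} (h : P.HasValue f a) : P.val f ≤ 1 :=
  Valuation.le_one_of_sub_lt_one P.val_algebraMap_le_one h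

theorem HasValue.unique {f : K} {a b : k} (ha : P.HasValue f a) (hb : P.HasValue f b) : a = b :=
  Valuation.eq_of_sub_lt_one P.val_algebraMap_le_one ha hb

theorem HasValue.add {f g : K} {a b : k} (hf : P.HasValue f a) (hg : P.HasValue g b) :
    P.HasValue (f + g) (a + b) :=
  Valuation.add_sub_add_lt_one hf hg

theorem HasValue.mul {f g : K} {a b : k} (hf : P.HasValue f a) (hg : P.HasValue g b) :
    P.HasValue (f * g) (a * b) :=
  Valuation.mul_sub_mul_lt_one P.val_algebraMap_le_one hf hg

theorem hasValue_algebraMap (P : Place k K) (a : k) : P.HasValue (algebraMap k K a) a := by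
  simp [HasValue]

theorem hasValue_zero_iff {f : K} : P.HasValue f 0 ↔ P.val f < 1 := by
  simp [HasValue]

theorem HasValue.val_eq_one {f : K} {a : k} (h : P.HasValue f a) (ha : a ≠ 0) : P.val f = 1 := by
  have h2 := Valuation.algebraMap_eq_one_of_le_one P.val_algebraMap_le_one ha
  have := Valuation.map_add_eq_of_lt_right P.val (lt_of_lt_of_eq h h2.symm)
  rwa [sub_add_cancel, h2] at this

theorem HasValue.ne_zero {f : K} {a : k} (h : P.HasValue f a) (ha : a ≠ 0) : f ≠ 0 := by
  rintro rfl
  simpa using h.val_eq_one ha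

theorem HasValue.inv {f : K} {a : k} (h : P.HasValue f a) (ha : a ≠ 0) :
    P.HasValue f⁻¹ a⁻¹ := by
  have hf0 := h.ne_zero ha
  have ha0 : algebraMap k K a ≠ 0 := by simpa using ha
  have e : f⁻¹ - algebraMap k K a⁻¹ = -((f - algebraMap k K a) * (f⁻¹ * algebraMap k K a⁻¹)) := by
    rw [map_inv₀]
    field_simp
    ring
  rw [HasValue, e, Valuation.map_neg, map_mul]
  refine mul_lt_one_of_lt_of_le h ?_
  rw [map_mul, map_inv₀, h.val_eq_one ha, inv_one, one_mul]
  exact P.val_algebraMap_le_one _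

theorem HasValue.div {f g : K} {a b : k} (hf : P.HasValue f a) (hg : P.HasValue g b)
    (hb : b ≠ 0) : P.HasValue (f / g) (a / b) := by
  rw [div_eq_mul_inv, div_eq_mul_inv]
  exact hf.mul (hg.inv hb)

theorem HasValue.aeval {σ : Type*} {g : σ → K} {w : σ → k} (h : ∀ i, P.HasValue (g i) (w i))
    (F : MvPolynomial σ k) : P.HasValue (MvPolynomial.aeval g F) (MvPolynomial.eval w F) := by
  induction F using MvPolynomial.induction_on with
  | C a => simpa using P.hasValue_algebraMap a
  | add F G hF hG => simpa using hF.add hG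
  | mul_X F i hF => simpa using hF.mul (h i)

variable {n : ℕ} {f : Fin (n + 1) → K}

theorem mapsTo_mk {t : K} (ht : t ≠ 0) {w : Fin (n + 1) → k} (hw : w ≠ 0)
    (h : ∀ i, P.HasValue (t * f i) (w i)) : P.MapsTo f (Projectivization.mk k w hw) := by
  obtain ⟨a, ha⟩ := Projectivization.exists_smul_eq_mk_rep k w hw
  refine ⟨algebraMap k K a * t, mul_ne_zero (by simp) ht, fun i => ?_⟩
  rw [← ha, mul_assoc]
  exact (P.hasValue_algebraMap _).mul (h i)

theorem _root_.Projectivization.exists_rep_ne_zero {ι : Type*} (r : ℙ k (ι → k)) :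
    ∃ j, r.rep j ≠ 0 :=
  Function.ne_iff.1 r.rep_nonzero

theorem MapsTo.hasValue_div {r : ℙ k (Fin (n + 1) → k)} (h : P.MapsTo f r) {j : Fin (n + 1)}
    (hj : r.rep j ≠ 0) (i : Fin (n + 1)) : P.HasValue (f i / f j) (r.rep i / r.rep j) := by
  obtain ⟨t, ht, h⟩ := h
  rw [← mul_div_mul_left _ _ ht]
  exact (h i).div (h j) hj

theorem MapsTo.coord_ne_zero {r : ℙ k (Fin (n + 1) → k)} (h : P.MapsTo f r) {j : Fin (n + 1)}
    (hj : r.rep j ≠ 0) : f j ≠ 0 := by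
  obtain ⟨t, ht, h⟩ := h
  exact right_ne_zero_of_mul ((h j).ne_zero hj)

/-- A coordinate of minimal order cannot vanish at the image point, since otherwise all coordinates
would. -/
theorem MapsTo.rep_ne_zero {r : ℙ k (Fin (n + 1) → k)} (h : P.MapsTo f r) {j : Fin (n + 1)}
    (hj : f j ≠ 0) (hle : ∀ i, P.val (f i / f j) ≤ 1) : r.rep j ≠ 0 := by
  obtain ⟨t, ht, h⟩ := h
  intro h0
  apply r.rep_nonzero
  funext i
  have h1 := h j
  rw [h0, hasValue_zero_iff] at h1
  refine (h i).unique (hasValue_zero_iff.2 ?_)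
  have : t * f i = t * f j * (f i / f j) := by field_simp
  rw [this, map_mul]
  exact mul_lt_one_of_lt_of_le h1 (hle i)

theorem MapsTo.unique {r s : ℙ k (Fin (n + 1) → k)} (hr : P.MapsTo f r) (hs : P.MapsTo f s) :
    r = s := by
  obtain ⟨j, hj⟩ := r.exists_rep_ne_zero
  have hj' := hs.rep_ne_zero (hr.coord_ne_zero hj) fun i => (hr.hasValue_div hj i).val_le_one
  rw [← r.mk_rep, ← s.mk_rep, Projectivization.mk_eq_mk_iff']
  refine ⟨r.rep j / s.rep j, ?_⟩
  funext i
  have := (hr.hasValue_div hj i).unique (hs.hasValue_div hj' i)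
  rw [Pi.smul_apply, smul_eq_mul]
  field_simp at this ⊢
  linear_combination -this

end Place

variable {n : ℕ}

/-- `g` is a quotient of two forms of the same degree in `f₀, …, fₙ` whose denominator does not
vanish at the point `r` of projective space. -/
def IsRatioOfForms (f : Fin (n + 1) → K) (r : ℙ k (Fin (n + 1) → k)) (g : K) : Prop :=
  ∃ (d : ℕ) (F G : MvPolynomial (Fin (n + 1)) k), F.IsHomogeneous d ∧ G.IsHomogeneous d ∧
    MvPolynomial.eval r.rep G ≠ 0 ∧ g * MvPolynomial.aeval f G = MvPolynomial.aeval f F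

namespace IsRatioOfForms

variable {f : Fin (n + 1) → K} {r : ℙ k (Fin (n + 1) → k)} {g h : K}

theorem algebraMap (f : Fin (n + 1) → K) (r : ℙ k (Fin (n + 1) → k)) (a : k) :
    IsRatioOfForms f r (algebraMap k K a) :=
  ⟨0, MvPolynomial.C a, 1, MvPolynomial.isHomogeneous_C _ _, MvPolynomial.isHomogeneous_one _ _,
    by simp, by simp⟩

theorem add (hg : IsRatioOfForms f r g) (hh : IsRatioOfForms f r h) :
    IsRatioOfForms f r (g + h) := by
  obtain ⟨d, F, G, hF, hG, hG0, e⟩ := hg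
  obtain ⟨d', F', G', hF', hG', hG0', e'⟩ := hh
  refine ⟨d + d', F * G' + G * F', G * G', (hF.mul hG').add (hG.mul hF'), hG.mul hG', ?_, ?_⟩
  · rw [map_mul]
    exact mul_ne_zero hG0 hG0'
  · simp only [map_add, map_mul, ← e, ← e']
    ring

theorem mul (hg : IsRatioOfForms f r g) (hh : IsRatioOfForms f r h) :
    IsRatioOfForms f r (g * h) := by
  obtain ⟨d, F, G, hF, hG, hG0, e⟩ := hg
  obtain ⟨d', F', G', hF', hG', hG0', e'⟩ := hh
  refine ⟨d + d', F * F', G * G', hF.mul hF', hG.mul hG', ?_, ?_⟩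
  · rw [map_mul]
    exact mul_ne_zero hG0 hG0'
  · simp only [map_mul, ← e, ← e']
    ring

theorem coord_div {i j : Fin (n + 1)} (hj : f j ≠ 0) (hr : r.rep j ≠ 0) :
    IsRatioOfForms f r (f i / f j) :=
  ⟨1, MvPolynomial.X i, MvPolynomial.X j, MvPolynomial.isHomogeneous_X _ _,
    MvPolynomial.isHomogeneous_X _ _, by simpa using hr, by simp [hj]⟩

theorem of_mem_adjoin {j : Fin (n + 1)} (hj : f j ≠ 0) (hr : r.rep j ≠ 0)
    (hg : g ∈ Algebra.adjoin k (Set.range fun i => f i / f j)) : IsRatioOfForms f r g := by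
  induction hg using Algebra.adjoin_induction with
  | mem z hz => obtain ⟨i, rfl⟩ := hz; exact coord_div hj hr
  | algebraMap a => exact algebraMap f r a
  | add _ _ _ _ h1 h2 => exact h1.add h2
  | mul _ _ _ _ h1 h2 => exact h1.mul h2

end IsRatioOfForms

theorem Place.MapsTo.hasValue_ratio {P : Place k K} {f : Fin (n + 1) → K}
    {r : ℙ k (Fin (n + 1) → k)} (h : P.MapsTo f r) {g : K} {d : ℕ}
    {F G : MvPolynomial (Fin (n + 1)) k} (hF : F.IsHomogeneous d) (hG : G.IsHomogeneous d)
    (hG0 : MvPolynomial.eval r.rep G ≠ 0)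
    (e : g * MvPolynomial.aeval f G = MvPolynomial.aeval f F) :
    P.HasValue g (MvPolynomial.eval r.rep F / MvPolynomial.eval r.rep G) := by
  obtain ⟨t, ht, h⟩ := h
  have h1 := Place.HasValue.aeval h F
  have h2 := Place.HasValue.aeval h G
  have h3 := h1.div h2 hG0
  have h4 := h2.ne_zero hG0
  rw [hF.aeval_mul_left, ← e, hG.aeval_mul_left] at h3
  rw [hG.aeval_mul_left] at h4
  convert h3 using 1
  field_simp [right_ne_zero_of_mul h4]

theorem Place.MapsTo.aeval_ne_zero {P : Place k K} {f : Fin (n + 1) → K}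
    {r : ℙ k (Fin (n + 1) → k)} (h : P.MapsTo f r) {d : ℕ}
    {G : MvPolynomial (Fin (n + 1)) k} (hG : G.IsHomogeneous d)
    (hG0 : MvPolynomial.eval r.rep G ≠ 0) : MvPolynomial.aeval f G ≠ 0 := by
  obtain ⟨t, ht, h⟩ := h
  have h2 := (Place.HasValue.aeval h G).ne_zero hG0
  rw [hG.aeval_mul_left] at h2
  exact right_ne_zero_of_mul h2

theorem IsRatioOfForms.exists_hasValue {P : Place k K} {f : Fin (n + 1) → K}
    {r : ℙ k (Fin (n + 1) → k)} (h : P.MapsTo f r) {g : K} (hg : IsRatioOfForms f r g) :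
    ∃ a, P.HasValue g a := by
  obtain ⟨d, F, G, hF, hG, hG0, e⟩ := hg
  exact ⟨_, h.hasValue_ratio hF hG hG0 e⟩

/-- For a unit g the numerator is also nonzero at r, since the ratio of the two evaluations is the
value of g at P. -/
theorem IsRatioOfForms.inv {P : Place k K} {f : Fin (n + 1) → K}
    {r : ℙ k (Fin (n + 1) → k)} (h : P.MapsTo f r) {g : K} (hg : IsRatioOfForms f r g)
    (h1 : P.val g = 1) : IsRatioOfForms f r g⁻¹ := by
  obtain ⟨d, F, G, hF, hG, hG0, e⟩ := hg
  have hg0 : g ≠ 0 := by rintro rfl; simp at h1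
  refine ⟨d, G, F, hG, hF, fun h0 => ?_, ?_⟩
  · have h2 := h.hasValue_ratio hF hG hG0 e
    rw [h0, zero_div, Place.hasValue_zero_iff] at h2
    exact h2.ne h1
  · rw [← e]
    field_simp

/-- Every valuation subring of `K / k` other than `K` itself is a discrete valuation ring whose
elements are quotients of polynomials in the affine coordinates `fᵢ / fⱼ` of some chart. -/
def HasCharts (k : Type*) {K : Type*} [Field k] [Field K] [Algebra k K]
    (f : Fin (n + 1) → K) : Prop :=
  ∀ V : ValuationSubring K, (∀ a : k, algebraMap k K a ∈ V) → V ≠ ⊤ →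
    IsDiscreteValuationRing V ∧ ∃ j : Fin (n + 1), f j ≠ 0 ∧
      (∀ i, ∃ r : k, V.valuation (f i / f j - algebraMap k K r) < 1) ∧
      ∀ g ∈ V, ∃ a ∈ Algebra.adjoin k (Set.range fun i => f i / f j),
        ∃ b ∈ Algebra.adjoin k (Set.range fun i => f i / f j), V.valuation b = 1 ∧ g = a / b

namespace HasCharts

variable {f : Fin (n + 1) → K} (hf : HasCharts k f)
include hf

theorem exists_mapsTo (P : Place k K) : ∃ r, P.MapsTo f r := by
  obtain ⟨-, j, hj, h, -⟩ := hf P.ring P.algebraMap_mem P.ring_ne_top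
  choose w hw using h
  have hw' : ∀ i, P.HasValue (f i / f j) (w i) := fun i => (P.val_lt_one_iff _).2 (hw i)
  have hwj : w j = 1 := by
    refine (hw' j).unique ?_
    rw [div_self hj, ← map_one (algebraMap k K)]
    exact P.hasValue_algebraMap 1
  refine ⟨_, Place.mapsTo_mk (t := (f j)⁻¹) (inv_ne_zero hj) (w := w) ?_ fun i => ?_⟩
  · rintro rfl
    simp at hwj
  · rw [mul_comm, ← div_eq_mul_inv]
    exact hw' i

theorem isRatioOfForms {P : Place k K} {r : ℙ k (Fin (n + 1) → k)} (h : P.MapsTo f r) {g : K}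
    (hg : g ∈ P.ring) : IsRatioOfForms f r g := by
  obtain ⟨-, j, hj, hv, hgen⟩ := hf P.ring P.algebraMap_mem P.ring_ne_top
  have hr : r.rep j ≠ 0 := h.rep_ne_zero hj fun i => by
    obtain ⟨a, ha⟩ := hv i
    exact Place.HasValue.val_le_one ((P.val_lt_one_iff _).2 ha)
  obtain ⟨a, ha, b, hb, h1, rfl⟩ := hgen g hg
  rw [div_eq_mul_inv]
  exact (IsRatioOfForms.of_mem_adjoin hj hr ha).mul
    ((IsRatioOfForms.of_mem_adjoin hj hr hb).inv h ((P.val_eq_one_iff b).2 h1))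

/-- Being a ratio of forms regular at r refers only to the image point. So functions regular at P
are regular at Q, and conversely. -/
theorem eq_of_mapsTo {P Q : Place k K} {r : ℙ k (Fin (n + 1) → k)} (hP : P.MapsTo f r)
    (hQ : Q.MapsTo f r) : P = Q := by
  have key : ∀ {P Q : Place k K}, P.MapsTo f r → Q.MapsTo f r → P.ring ≤ Q.ring := by
    intro P Q hP hQ g hg
    obtain ⟨a, ha⟩ := (hf.isRatioOfForms hP hg).exists_hasValue hQ
    exact (Q.val_le_one_iff g).1 ha.val_le_one
  exact Place.ext (le_antisymm (key hP hQ) (key hQ hP))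

end HasCharts

end AlgCurve

/-! ### A criterion for a map with charts to be an embedding -/

namespace AlgCurve

variable {k K : Type*} [Field k] [Field K] [Algebra k K] {n : ℕ}

theorem isOpen_eval_ne_zero {d : ℕ} {F : MvPolynomial (Fin (n + 1)) k} (hF : F.IsHomogeneous d) :
    IsOpen {r : ℙ k (Fin (n + 1) → k) | MvPolynomial.eval r.rep F ≠ 0} :=
  TopologicalSpace.GenerateOpen.basic _ ⟨d, F, hF, rfl⟩

theorem isClosed_eval_eq_zero {d : ℕ} {F : MvPolynomial (Fin (n + 1)) k}
    (hF : F.IsHomogeneous d) :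
    IsClosed {r : ℙ k (Fin (n + 1) → k) | MvPolynomial.eval r.rep F = 0} :=
  ⟨isOpen_eval_ne_zero hF⟩

instance t1Space_projectivization : T1Space (ℙ k (Fin (n + 1) → k)) where
  t1 r := by
    obtain ⟨j, hj⟩ := r.exists_rep_ne_zero
    -- A point is cut out by the linear forms r_j·X_i - r_i·X_j, for a fixed j with r_j ≠ 0.
    have h : ({r} : Set (ℙ k (Fin (n + 1) → k))) = ⋂ i, {s | MvPolynomial.eval s.rep
        (MvPolynomial.C (r.rep j) * MvPolynomial.X i
          - MvPolynomial.C (r.rep i) * MvPolynomial.X j) = 0} := by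
      ext s
      simp only [Set.mem_singleton_iff, Set.mem_iInter, Set.mem_ofPred_eq, map_sub, map_mul,
        MvPolynomial.eval_C, MvPolynomial.eval_X]
      constructor
      · rintro rfl i
        ring
      · intro h
        rw [← s.mk_rep, ← r.mk_rep, Projectivization.mk_eq_mk_iff']
        refine ⟨s.rep j / r.rep j, funext fun i => ?_⟩
        rw [Pi.smul_apply, smul_eq_mul]
        field_simp
        linear_combination -h i
    rw [h]
    exact isClosed_iInter fun i => isClosed_eval_eq_zero
      ((MvPolynomial.isHomogeneous_C_mul_X _ _).sub (MvPolynomial.isHomogeneous_C_mul_X _ _))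

namespace HasCharts

variable {f : Fin (n + 1) → K} (hf : HasCharts k f)
include hf

omit hf in
theorem finite_eval_eq_zero (hz : ∀ g : K, g ≠ 0 → {P : Place k K | P.val g < 1}.Finite)
    {φ : Place k K → ℙ k (Fin (n + 1) → k)} (hφ : ∀ P : Place k K, P.MapsTo f (φ P)) {d : ℕ}
    {F : MvPolynomial (Fin (n + 1)) k} (hF : F.IsHomogeneous d)
    (h0 : MvPolynomial.aeval f F ≠ 0) :
    {P | MvPolynomial.eval (φ P).rep F = 0}.Finite := by
  refine (Set.finite_iUnion fun j : {j // f j ≠ 0} =>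
    hz (MvPolynomial.aeval f F / f j ^ d) (div_ne_zero h0 (pow_ne_zero _ j.2))).subset ?_
  intro P hP
  obtain ⟨j, hj⟩ := (φ P).exists_rep_ne_zero
  refine Set.mem_iUnion.2 ⟨⟨j, (hφ P).coord_ne_zero hj⟩, ?_⟩
  have h1 := (hφ P).hasValue_ratio (g := MvPolynomial.aeval f F / f j ^ d) hF
    (MvPolynomial.isHomogeneous_X_pow j d) (by simpa using fun h => absurd h hj)
    (by simp [(hφ P).coord_ne_zero hj])
  rw [show MvPolynomial.eval (φ P).rep F = 0 from hP, zero_div, Place.hasValue_zero_iff] at h1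
  exact h1

/-- The image contains every point satisfying all homogeneous relations among the fᵢ. After
homogenization, evaluation at r is well defined on k[f₀/fⱼ, …, fₙ/fⱼ]. A valuation ring dominating
its kernel is proper because some fᵢ/fⱼ is not constant, and by the charts it is a place. -/
theorem exists_mapsTo_of_forall_eval_eq_zero
    (hnc : ∀ j, f j ≠ 0 → ∃ i, f i / f j ∉ Set.range (algebraMap k K))
    {r : ℙ k (Fin (n + 1) → k)}
    (hr : ∀ (d : ℕ) (F : MvPolynomial (Fin (n + 1)) k), F.IsHomogeneous d →
      MvPolynomial.aeval f F = 0 → MvPolynomial.eval r.rep F = 0) :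
    ∃ P : Place k K, P.MapsTo f r := by
  obtain ⟨j, hj⟩ := r.exists_rep_ne_zero
  have hfj : f j ≠ 0 := by
    intro h
    have h1 := hr 1 (MvPolynomial.X j) (MvPolynomial.isHomogeneous_X _ _) (by simpa using h)
    exact hj (by simpa using h1)
  set τ : Fin (n + 1) → K := fun i => f i / f j with hτ
  set ρ : Fin (n + 1) → k := fun i => r.rep i / r.rep j with hρ
  have hker : ∀ H : MvPolynomial (Fin (n + 1)) k, MvPolynomial.aeval τ H = 0 →
      MvPolynomial.aeval ρ H = 0 := by
    intro H hH
    have h1 := hr _ _ (H.isHomogeneous_homogenizeAt j) (by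
      rw [H.aeval_homogenizeAt hfj, hH, mul_zero])
    rw [← MvPolynomial.coe_aeval_eq_eval, RingHom.coe_coe, H.aeval_homogenizeAt hj] at h1
    exact (mul_eq_zero.1 h1).resolve_left (pow_ne_zero _ hj)
  let A := (MvPolynomial.aeval (R := k) τ).toRingHom.range
  let I : Ideal A := (RingHom.ker (MvPolynomial.aeval (R := k) ρ)).map
    (MvPolynomial.aeval (R := k) τ).toRingHom.rangeRestrict
  have hsurj := (MvPolynomial.aeval (R := k) τ).toRingHom.rangeRestrict_surjective
  have hI : I ≠ ⊤ := by
    intro h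
    have h1 : (1 : A) ∈ I := by rw [h]; trivial
    obtain ⟨H, hH, hH1⟩ := (Ideal.mem_map_iff_of_surjective _ hsurj).1 h1
    have hH1' : MvPolynomial.aeval τ H = 1 := congrArg Subtype.val hH1
    have h2 := hker (H - 1) (by rw [map_sub, hH1', map_one, sub_self])
    rw [map_sub, (RingHom.mem_ker).1 hH, map_one, zero_sub, neg_eq_zero] at h2
    exact one_ne_zero h2
  obtain ⟨V, hAV, hV⟩ := Subring.exists_valuationSubring_valuation_lt_one A I hI
  have hk : ∀ a : k, algebraMap k K a ∈ V := fun a => hAV ⟨MvPolynomial.C a, by simp⟩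
  have hval : ∀ i, V.valuation (τ i - algebraMap k K (ρ i)) < 1 := by
    intro i
    have h1 := hV _ (Ideal.mem_map_of_mem (MvPolynomial.aeval (R := k) τ).toRingHom.rangeRestrict
      (x := MvPolynomial.X i - MvPolynomial.C (ρ i))
      (by rw [RingHom.mem_ker]; simp))
    have h2 : MvPolynomial.aeval τ (MvPolynomial.X i - MvPolynomial.C (ρ i)) =
        τ i - algebraMap k K (ρ i) := by simp
    rw [← h2]
    exact h1
  have hVtop : V ≠ ⊤ := by
    obtain ⟨i, hi⟩ := hnc j hfj
    exact ValuationSubring.ne_top_of_valuation_lt_one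
      (fun h => hi ⟨ρ i, (sub_eq_zero.1 h).symm⟩) (hval i)
  let P : Place k K := ⟨V, (hf V hk hVtop).1, hk⟩
  refine ⟨P, algebraMap k K (r.rep j) * (f j)⁻¹, by simpa using ⟨hj, hfj⟩, fun i => ?_⟩
  have h1 : P.HasValue (τ i) (ρ i) := (P.val_lt_one_iff _).2 (hval i)
  have h2 := (P.hasValue_algebraMap (r.rep j)).mul h1
  convert h2 using 1
  · rw [hτ]; ring
  · rw [hρ]; field_simp

/-- The closed sets of the curve are the finite sets and the whole curve. Finite sets of zeros give
continuity, finite images are closed because points are, and the full image is the zero locus of all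
forms vanishing on f. -/
theorem isClosedEmbedding (hz : ∀ g : K, g ≠ 0 → {P : Place k K | P.val g < 1}.Finite)
    (hnc : ∀ j, f j ≠ 0 → ∃ i, f i / f j ∉ Set.range (algebraMap k K))
    {φ : Place k K → ℙ k (Fin (n + 1) → k)} (hφ : ∀ P : Place k K, P.MapsTo f (φ P)) :
    Topology.IsClosedEmbedding φ := by
  have hinj : Function.Injective φ := fun P Q h => hf.eq_of_mapsTo (hφ P) (h ▸ hφ Q)
  refine .of_continuous_injective_isClosedMap ?_ hinj ?_
  · refine continuous_generateFrom_iff.2 ?_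
    rintro _ ⟨d, F, hF, rfl⟩
    rw [isOpen_place_iff]
    rintro ⟨P, hP⟩
    have := finite_eval_eq_zero hz hφ hF ((hφ P).aeval_ne_zero hF hP)
    convert this using 1
    ext Q
    simp
  · intro T hT
    rw [← isOpen_compl_iff, isOpen_place_iff, compl_compl] at hT
    rcases Set.eq_empty_or_nonempty Tᶜ with h | h
    · rw [Set.compl_empty_iff.1 h, Set.image_univ]
      have hr : Set.range φ = ⋂ F : {F : MvPolynomial (Fin (n + 1)) k //
          (∃ d, F.IsHomogeneous d) ∧ MvPolynomial.aeval f F = 0},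
          {r | MvPolynomial.eval r.rep F.1 = 0} := by
        ext r
        simp only [Set.mem_range, Set.mem_iInter, Set.mem_ofPred_eq]
        constructor
        · rintro ⟨P, rfl⟩ ⟨F, ⟨d, hF⟩, hF0⟩
          by_contra h0
          exact (hφ P).aeval_ne_zero hF h0 hF0
        · intro h
          obtain ⟨P, hP⟩ := hf.exists_mapsTo_of_forall_eval_eq_zero hnc
            fun d F hF hF0 => h ⟨F, ⟨d, hF⟩, hF0⟩
          exact ⟨P, (hφ P).unique hP⟩
      rw [hr]
      refine isClosed_iInter fun F => ?_
      obtain ⟨F, ⟨d, hF⟩, hF0⟩ := F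
      exact isClosed_eval_eq_zero hF
    · exact ((hT h).image φ).isClosed

theorem isEmbedding (hz : ∀ g : K, g ≠ 0 → {P : Place k K | P.val g < 1}.Finite)
    (hnc : ∀ j, f j ≠ 0 → ∃ i, f i / f j ∉ Set.range (algebraMap k K))
    {φ : Place k K → ℙ k (Fin (n + 1) → k)} (hφ : ∀ P : Place k K, P.MapsTo f (φ P)) : IsEmbedding φ where
  isClosedEmbedding := hf.isClosedEmbedding hz hnc hφ
  regular_iff U hU h := by
    have hce := hf.isClosedEmbedding hz hnc hφ
    constructor
    · intro H P hP
      obtain ⟨W, hW, hPW, d, F, G, hF, hG, hFG⟩ := H (φ P) ⟨P, hP, rfl⟩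
      refine ⟨φ ⁻¹' W, hW.preimage hce.continuous, hPW,
        MvPolynomial.aeval f F / MvPolynomial.aeval f G, ?_⟩
      rintro Q ⟨hQW, hQU⟩
      obtain ⟨h1, h2⟩ := hFG (φ Q) ⟨hQW, Q, hQU, rfl⟩
      rw [Function.comp_apply, h2]
      exact (hφ Q).hasValue_ratio hF hG h1 (div_mul_cancel₀ _ ((hφ Q).aeval_ne_zero hG h1))
    -- The local representative g is regular at P, hence a ratio F/G of forms with G nonzero at
    -- φ(P). That same ratio computes its values wherever G does not vanish.
    · rintro H _ ⟨P, hP, rfl⟩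
      obtain ⟨W, hW, hPW, g, hg⟩ := H P hP
      obtain ⟨W', hW', hWW'⟩ := hce.isInducing.isOpen_iff.1 hW
      obtain ⟨d, F, G, hF, hG, hG0, e⟩ := hf.isRatioOfForms (hφ P)
        ((P.val_le_one_iff g).1 (hg P ⟨hPW, hP⟩).val_le_one)
      refine ⟨W' ∩ {r | MvPolynomial.eval r.rep G ≠ 0}, hW'.inter (isOpen_eval_ne_zero hG),
        ⟨?_, hG0⟩, d, F, G, hF, hG, ?_⟩
      · rw [← hWW'] at hPW
        exact hPW
      · rintro _ ⟨⟨h1, h2⟩, Q, hQ, rfl⟩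
        refine ⟨h2, (hg Q ⟨?_, hQ⟩).unique ((hφ Q).hasValue_ratio hF hG h2 e)⟩
        rw [← hWW']
        exact h1

end HasCharts

end AlgCurve

/-! ### Places of the curve, finiteness and the embedding -/

open AlgCurve

namespace AlgCurve.Place

variable {k K : Type*} [Field k] [Field K] [Algebra k K] {P : Place k K}

theorem HasValue.aeval_polynomial {τ : K} {a : k} (h : P.HasValue τ a) (G : k[X]) :
    P.HasValue (Polynomial.aeval τ G) (G.eval a) :=
  Valuation.aeval_sub_eval_lt_one P.val_algebraMap_le_one h G

theorem HasValue.sum {ι : Type*} (s : Finset ι) {g : ι → K} {w : ι → k}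
    (h : ∀ i ∈ s, P.HasValue (g i) (w i)) : P.HasValue (∑ i ∈ s, g i) (∑ i ∈ s, w i) := by
  classical
  induction s using Finset.induction_on with
  | empty => simp [HasValue]
  | insert i s hi ih =>
    rw [Finset.sum_insert hi, Finset.sum_insert hi]
    exact (h i (Finset.mem_insert_self _ _)).add (ih fun j hj => h j (Finset.mem_insert_of_mem hj))

theorem HasValue.pow {τ : K} {a : k} (h : P.HasValue τ a) (m : ℕ) : P.HasValue (τ ^ m) (a ^ m) := by
  simpa using h.aeval_polynomial (X ^ m)

theorem HasValue.not_one_lt {τ : K} {a : k} (h : P.HasValue τ a) : ¬ 1 < P.val τ :=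
  not_lt.2 h.val_le_one

end AlgCurve.Place

namespace GenASM.Generators

variable {k K : Type*} [Field k] [Field K] [Algebra k K] [IsAlgClosed k] {p e : ℕ}
    {α₁ α₂ : ℕ → k} {c : k} {x y : K} [hp : Fact p.Prime] [CharP k p]

theorem hasCharts (S : Generators p e α₁ α₂ c x y) : HasCharts k ![x, y, 1, x * y] :=
  fun _ hk hV => S.exists_chart hk hV

omit [CharP k p] in
theorem hasValue_or_pole (S : Generators p e α₁ α₂ c x y) (P : Place k K) :
    (∃ a b, P.HasValue x a ∧ P.HasValue y b) ∨ 1 < P.val x ∨ 1 < P.val y := by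
  have := S.exists_value_or_pole P.algebraMap_mem P.ring_ne_top
  simp only [← P.val_lt_one_iff, ← P.one_lt_val_iff] at this
  exact this

theorem pole_left (S : Generators p e α₁ α₂ c x y) {P : Place k K} (hx : 1 < P.val x) :
    P.val x = WithZero.exp 1 ∧ ∃ β, (linearized p e α₂).eval β = 0 ∧ P.HasValue y β ∧
      P.val (y - algebraMap k K β) = WithZero.exp (-(p ^ e : ℕ) : ℤ) := by
  obtain ⟨β, hβ, hw, -, hu, -⟩ :=
    S.pole_chart P.algebraMap_mem ((P.one_lt_val_iff x).1 hx)
  have hu1 : P.val x⁻¹ < 1 := by rw [map_inv₀]; exact inv_lt_one_of_one_lt₀ hx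
  have h1 := P.val_uniformizer hu1 hu
  have hw' : P.val (y - algebraMap k K β) = P.val (x⁻¹ ^ p ^ e) := by
    refine P.isEquiv_valuation.eq_iff.2 ?_
    rw [hw, map_pow]
  rw [map_pow, h1, ← WithZero.exp_nsmul] at hw'
  have hw'' : P.val (y - algebraMap k K β) = WithZero.exp (-(p ^ e : ℕ) : ℤ) := by
    rw [hw']; simp
  refine ⟨?_, β, hβ, ?_, hw''⟩
  · rw [map_inv₀, WithZero.exp_neg, inv_inj] at h1
    exact h1
  · rw [Place.HasValue, hw'', ← WithZero.exp_zero, WithZero.exp_lt_exp]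
    have := pow_pos hp.out.pos e
    omega

theorem exists_place_value (S : Generators p e α₁ α₂ c x y) (a : k) :
    ∃ P : Place k K, P.HasValue x a := by
  obtain ⟨V, hk, hV, h⟩ := S.exists_valuationSubring_value a
  let P : Place k K := ⟨V, (S.exists_chart hk hV).1, hk⟩
  exact ⟨P, (P.val_lt_one_iff _).2 h⟩

/-- A place with x = a exists; if y were finite there, the equation would give 0·L₂(y) + c = 0. So y
has a pole, and the pole chart with x and y exchanged applies. -/
theorem exists_place_pole_right (S : Generators p e α₁ α₂ c x y) {a : k}
    (ha : (linearized p e α₁).eval a = 0) :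
    ∃ P : Place k K, P.val x ≤ 1 ∧ P.val y = WithZero.exp 1 ∧
      P.val (x - algebraMap k K a) = WithZero.exp (-(p ^ e : ℕ) : ℤ) := by
  obtain ⟨P, hP⟩ := S.exists_place_value a
  have hy : 1 < P.val y := by
    rcases S.hasValue_or_pole P with ⟨a', b, ha', hb⟩ | hx | hy
    · have h1 := S.eval_mul_eval P.val_algebraMap_le_one hP hb
      rw [ha, zero_mul, zero_add] at h1
      exact absurd h1 S.c_ne
    · exact absurd hx hP.not_one_lt
    · exact hy
  obtain ⟨h1, a', -, h3, h4⟩ := S.symm.pole_left hy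
  obtain rfl := h3.unique hP
  exact ⟨P, hP.val_le_one, h1, h4⟩

theorem subsingleton_point (S : Generators p e α₁ α₂ c x y) (a b : k) :
    {P : Place k K | P.HasValue x a ∧ P.HasValue y b}.Subsingleton := by
  have hw : ![a, b, 1, a * b] ≠ 0 := fun h => by simpa using congrFun h 2
  have key : ∀ P : Place k K, P.HasValue x a ∧ P.HasValue y b →
      P.MapsTo ![x, y, 1, x * y] (Projectivization.mk k _ hw) := by
    rintro P ⟨ha, hb⟩
    refine Place.mapsTo_mk one_ne_zero hw fun i => ?_
    fin_cases i
    · simpa using ha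
    · simpa using hb
    · simpa using P.hasValue_algebraMap 1
    · simpa using ha.mul hb
  intro P hP Q hQ
  exact S.hasCharts.eq_of_mapsTo (key P hP) (key Q hQ)

/-- Such places all map to (1 : 0 : 0 : β), so injectivity identifies them. -/
theorem subsingleton_pole_left (S : Generators p e α₁ α₂ c x y) (β : k) :
    {P : Place k K | 1 < P.val x ∧ P.HasValue y β}.Subsingleton := by
  have hw : ![1, 0, 0, β] ≠ 0 := fun h => by simpa using congrFun h 0
  have key : ∀ P : Place k K, 1 < P.val x ∧ P.HasValue y β →
      P.MapsTo ![x, y, 1, x * y] (Projectivization.mk k _ hw) := by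
    rintro P ⟨hx, hb⟩
    have hx0 : x ≠ 0 := by rintro rfl; simp at hx
    have hu : P.HasValue x⁻¹ 0 := by
      rw [Place.hasValue_zero_iff, map_inv₀]; exact inv_lt_one_of_one_lt₀ hx
    refine Place.mapsTo_mk (inv_ne_zero hx0) hw fun i => ?_
    fin_cases i
    · simpa [hx0] using P.hasValue_algebraMap 1
    · simpa using hu.mul hb
    · simpa using hu
    · simpa [hx0] using hb
  intro P hP Q hQ
  exact S.hasCharts.eq_of_mapsTo (key P hP) (key Q hQ)

theorem finite_pole_left (S : Generators p e α₁ α₂ c x y) :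
    {P : Place k K | 1 < P.val x}.Finite := by
  classical
  refine (Set.Finite.biUnion (linearized p e α₂).roots.toFinset.finite_toSet
    fun β _ => (S.subsingleton_pole_left β).finite).subset ?_
  intro P hP
  obtain ⟨-, β, hβ, hyβ, -⟩ := S.pole_left hP
  refine Set.mem_biUnion (x := β) ?_ ⟨hP, hyβ⟩
  simpa using ⟨linearized_ne_zero S.α₂_zero_ne, hβ⟩

/-- With d(x)g⁻¹ = ∑ nᵢ(x)yⁱ, an affine zero of g has x-value a root of d. Then y has finitely many
possible values, and each pair of values belongs to at most one place. The poles of x and y are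
finite in number. -/
theorem finite_zeros (S : Generators p e α₁ α₂ c x y) {g : K} (hg : g ≠ 0) :
    {P : Place k K | P.val g < 1}.Finite := by
  classical
  obtain ⟨d, hd, n, hn⟩ := S.exists_mul_eq_sum g⁻¹
  -- If L₁(a) = 0 the quotient is 0 by convention; the polynomial still has degree q, so no case
  -- distinction is needed.
  have hfib : ∀ a : k, (linearized p e α₂ + C (c / (linearized p e α₁).eval a)) ≠ 0 := by
    intro a h
    have := congrArg natDegree h
    rw [natDegree_add_C, natDegree_linearized p hp.out e α₂ S.α₂_e_ne, natDegree_zero] at this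
    exact pow_ne_zero _ hp.out.ne_zero this
  refine (((S.finite_pole_left).union S.symm.finite_pole_left).union
    (Set.Finite.biUnion d.roots.toFinset.finite_toSet fun a _ =>
      Set.Finite.biUnion (linearized p e α₂ +
        C (c / (linearized p e α₁).eval a)).roots.toFinset.finite_toSet
        fun b _ => (S.subsingleton_point a b).finite)).subset ?_
  intro P hP
  rcases S.hasValue_or_pole P with ⟨a, b, ha, hb⟩ | hx | hy
  · refine Or.inr (Set.mem_biUnion (x := a) ?_ (Set.mem_biUnion (x := b) ?_ ⟨ha, hb⟩))
    · have h1 : P.HasValue (aeval x d) 0 := by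
        have h2 : aeval x d = g * ∑ i ∈ Finset.range (p ^ e), aeval x (n i) * y ^ i := by
          rw [← hn]; field_simp
        have h3 := (Place.hasValue_zero_iff.2 hP).mul (Place.HasValue.sum (Finset.range (p ^ e))
          fun i _ => (ha.aeval_polynomial (n i)).mul (hb.pow i))
        rwa [← h2, zero_mul] at h3
      have h2 := (ha.aeval_polynomial d).unique h1
      simpa using ⟨hd, h2⟩
    · have hab := S.eval_mul_eval P.val_algebraMap_le_one ha hb
      have ha0 : (linearized p e α₁).eval a ≠ 0 := by
        intro h
        rw [h, zero_mul, zero_add] at hab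
        exact S.c_ne hab
      have : (linearized p e α₂).eval b + c / (linearized p e α₁).eval a = 0 := by
        field_simp
        linear_combination hab
      simpa using ⟨hfib a, this⟩
  · exact Or.inl (Or.inl hx)
  · exact Or.inl (Or.inr hy)

omit hp [IsAlgClosed k] [CharP k p] in
theorem notMem_range_left (S : Generators p e α₁ α₂ c x y) :
    x ∉ Set.range (algebraMap k K) := by
  rintro ⟨a, rfl⟩
  exact S.transcendental (isAlgebraic_algebraMap a)

omit [CharP k p] in
-- Supplies the nonconstancy condition that keeps the dominating valuation rings from being all of
-- K.
theorem exists_ratio_notMem_range (S : Generators p e α₁ α₂ c x y) (j : Fin 4) :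
    ∃ i, ![x, y, 1, x * y] i / ![x, y, 1, x * y] j ∉ Set.range (algebraMap k K) := by
  have hx := S.notMem_range_left
  have hy := S.symm.notMem_range_left
  have hinv : ∀ z : K, z ∉ Set.range (algebraMap k K) → z⁻¹ ∉ Set.range (algebraMap k K) := by
    rintro z hz ⟨a, ha⟩
    exact hz ⟨a⁻¹, by rw [map_inv₀, ha, inv_inv]⟩
  have hy0 : y ≠ 0 := by rintro rfl; exact hy ⟨0, map_zero _⟩
  fin_cases j
  · exact ⟨2, by simpa using hinv x hx⟩
  · exact ⟨2, by simpa using hinv y hy⟩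
  · exact ⟨0, by simpa using hx⟩
  · refine ⟨1, ?_⟩
    have h : y / (x * y) = x⁻¹ := by field_simp
    simpa [h] using hinv x hx

theorem exists_isEmbedding (S : Generators p e α₁ α₂ c x y) :
    ∃ φ : Place k K → ℙ k (Fin 4 → k),
      (∀ (P : Place k K) (r : ℙ k (Fin 4 → k)), P.MapsTo ![x, y, 1, x * y] r ↔ r = φ P) ∧
      IsEmbedding φ := by
  choose φ hφ using S.hasCharts.exists_mapsTo
  refine ⟨φ, fun P r => ⟨fun h => h.unique (hφ P), fun h => h ▸ hφ P⟩, ?_⟩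
  exact S.hasCharts.isEmbedding (fun g hg => S.finite_zeros hg)
    (fun j _ => S.exists_ratio_notMem_range j) hφ

end GenASM.Generators

/-! ### The Riemann–Roch space of D -/

theorem Polynomial.eq_zero_of_forall_sum_mul_pow_eq_zero {k : Type*} [Field k] {q : ℕ} {u : ℕ → k}
    {s : Finset k} (hs : s.card = q) (h : ∀ b ∈ s, ∑ i ∈ Finset.range q, u i * b ^ i = 0) {i : ℕ}
    (hi : i < q) : u i = 0 := by
  set G : k[X] := ∑ i ∈ Finset.range q, C (u i) * X ^ i with hG
  have hdeg : G.natDegree < s.card := by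
    rw [hs]
    have hq : 0 < q := (Nat.zero_le i).trans_lt hi
    refine (natDegree_sum_le_of_forall_le (n := q - 1) _ _ fun i hi => ?_).trans_lt
      (Nat.sub_lt hq one_pos)
    exact (natDegree_C_mul_X_pow_le _ _).trans (Nat.le_sub_one_of_lt (Finset.mem_range.1 hi))
  have hG0 : G = 0 := eq_zero_of_natDegree_lt_card_of_eval_eq_zero' G s
    (fun b hb => by simpa [hG, eval_finsetSum] using h b hb) hdeg
  have := congrArg (fun G => coeff G i) hG0
  simpa [hG, finsetSum_coeff, coeff_C_mul, coeff_X_pow, hi] using this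

namespace AlgCurve.Place

variable {k K : Type*} [Field k] [Field K] [Algebra k K] {P : Place k K}

theorem HasValue.inv_pow_mul_aeval {x : K} (hx : x ≠ 0) (h : P.HasValue x⁻¹ 0) {G : k[X]} {m : ℕ}
    (hG : G.natDegree ≤ m) : P.HasValue (x⁻¹ ^ m * Polynomial.aeval x G) (G.coeff m) := by
  let _ := invertibleOfNonzero hx
  have h1 := eval₂_reflect_mul_pow (algebraMap k K) x m G hG
  have h2 := h.aeval_polynomial (reflect m G)
  rw [← coeff_zero_eq_eval_zero, coeff_reflect, revAt_le (Nat.zero_le m), Nat.sub_zero] at h2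
  convert h2 using 1
  rw [Polynomial.aeval_def, ← h1, invOf_eq_inv, Polynomial.aeval_def, mul_comm, mul_assoc,
    ← mul_pow, mul_inv_cancel₀ hx, one_pow, mul_one]

/-- If `y` has a simple pole at `P` and `x - a` vanishes to order `q` there, then the pole order of
`∑ nᵢ(x) yⁱ`, `i < q`, is the largest `i` with `nᵢ(a) ≠ 0`. -/
theorem eval_eq_zero_of_val_sum_le {x y : K} {a : k} {q : ℕ} (hq : 0 < q)
    (hx : P.val (x - algebraMap k K a) = WithZero.exp (-(q : ℕ) : ℤ))
    (hy : P.val y = WithZero.exp 1) {n : ℕ → k[X]} {m : ℤ}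
    (h : P.val (∑ i ∈ Finset.range q, Polynomial.aeval x (n i) * y ^ i) ≤ WithZero.exp m) {i : ℕ}
    (hi : i < q) (hmi : m < i) : (n i).eval a = 0 := by
  classical
  by_contra h0
  have hxa : P.HasValue x a := by
    rw [HasValue, hx, ← WithZero.exp_zero, WithZero.exp_lt_exp]
    omega
  obtain ⟨i₀, hi₀, hmax⟩ := ((Finset.range q).filter fun i => (n i).eval a ≠ 0).exists_max_image id
    ⟨i, Finset.mem_filter.2 ⟨Finset.mem_range.2 hi, h0⟩⟩
  rw [Finset.mem_filter] at hi₀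
  have hii₀ : i ≤ i₀ := hmax i (Finset.mem_filter.2 ⟨Finset.mem_range.2 hi, h0⟩)
  have hpow : ∀ j : ℕ, P.val (y ^ j) = WithZero.exp (j : ℤ) := fun j => by
    rw [map_pow, hy, ← WithZero.exp_nsmul]; simp
  have hlead : P.val (Polynomial.aeval x (n i₀) * y ^ i₀) = WithZero.exp (i₀ : ℤ) := by
    rw [map_mul, (hxa.aeval_polynomial (n i₀)).val_eq_one hi₀.2, one_mul, hpow]
  have hrest : P.val (∑ j ∈ (Finset.range q).erase i₀, Polynomial.aeval x (n j) * y ^ j) <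
      WithZero.exp (i₀ : ℤ) := by
    refine Valuation.map_sum_lt _ WithZero.exp_ne_zero fun j hj => ?_
    rw [Finset.mem_erase, Finset.mem_range] at hj
    rw [map_mul, hpow]
    rcases lt_or_gt_of_ne hj.1 with hlt | hlt
    · refine (mul_le_of_le_one_left' (hxa.aeval_polynomial (n j)).val_le_one).trans_lt ?_
      rw [WithZero.exp_lt_exp]
      exact_mod_cast hlt
    -- By maximality of i₀ the coefficient vanishes at a, hence to order at least q at P. This
    -- outweighs the pole of order j < q of y^j.
    · have hj0 : (n j).eval a = 0 := by
        by_contra hne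
        exact absurd (hmax j (Finset.mem_filter.2 ⟨Finset.mem_range.2 hj.2, hne⟩)) (not_le.2 hlt)
      obtain ⟨G, hG⟩ := dvd_iff_isRoot.2 hj0
      have h1 : P.val (Polynomial.aeval x (n j)) ≤ WithZero.exp (-(q : ℕ) : ℤ) := by
        rw [hG, map_mul, map_mul, _root_.map_sub, Polynomial.aeval_X, Polynomial.aeval_C, hx]
        exact mul_le_of_le_one_right' (hxa.aeval_polynomial G).val_le_one
      refine (mul_le_mul_left h1 _).trans_lt ?_
      rw [← WithZero.exp_add, WithZero.exp_lt_exp]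
      have := hj.2
      omega
  rw [← Finset.add_sum_erase _ _ hi₀.1,
    Valuation.map_add_eq_of_lt_left _ (hrest.trans_eq hlead.symm), hlead, WithZero.exp_le_exp] at h
  omega

end AlgCurve.Place

namespace GenASM.Generators

variable {k K : Type*} [Field k] [Field K] [Algebra k K] [IsAlgClosed k] {p e : ℕ}
    {α₁ α₂ : ℕ → k} {c : k} {x y : K} [hp : Fact p.Prime] [CharP k p]

theorem pole_cases (S : Generators p e α₁ α₂ c x y) (P : Place k K) :
    (P.val x ≤ 1 ∧ P.val y ≤ 1) ∨ (P.val x = WithZero.exp 1 ∧ P.val y ≤ 1) ∨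
      (P.val x ≤ 1 ∧ P.val y = WithZero.exp 1) := by
  rcases S.hasValue_or_pole P with ⟨a, b, ha, hb⟩ | hx | hy
  · exact Or.inl ⟨ha.val_le_one, hb.val_le_one⟩
  · obtain ⟨h1, β, -, h2, -⟩ := S.pole_left hx
    exact Or.inr (Or.inl ⟨h1, h2.val_le_one⟩)
  · obtain ⟨h1, β, -, h2, -⟩ := S.symm.pole_left hy
    exact Or.inr (Or.inr ⟨h2.val_le_one, h1⟩)

/-- Where one of x, y has a pole, the other is regular. -/
theorem val_mul_le (S : Generators p e α₁ α₂ c x y) (P : Place k K) :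
    P.val (x * y) ≤ max (P.val x) (max (P.val y) 1) := by
  rw [map_mul]
  rcases S.pole_cases P with ⟨hx, hy⟩ | ⟨hx, hy⟩ | ⟨hx, hy⟩
  · exact (mul_le_one' hx hy).trans (le_max_of_le_right (le_max_right _ _))
  · exact (mul_le_of_le_one_right' hy).trans (le_max_left _ _)
  · exact (mul_le_of_le_one_left' hx).trans (le_max_of_le_right (le_max_left _ _))

section RiemannRoch

variable (S : Generators p e α₁ α₂ c x y) {f : K}
  (hf : ∀ P : Place k K, P.val f ≤ max (P.val x) (max (P.val y) 1))
include S hf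

/-- If L₁(a) = 0, there is a pole of y with x = a where d(x) vanishes to order at least q and f has
at most a simple pole. So the sum has positive order and no nᵢ(a) can survive. Otherwise there are q
points (a, b) on the curve, d(x)f vanishes at each, and ∑ nᵢ(a)Tⁱ has degree below q but q roots. -/
theorem eval_eq_zero_of_isRoot
    (hpt : ∀ a b : k, (linearized p e α₁).eval a * (linearized p e α₂).eval b + c = 0 →
      ∃ P : Place k K, P.HasValue x a ∧ P.HasValue y b)
    {d : k[X]} {n : ℕ → k[X]}
    (hn : aeval x d * f = ∑ i ∈ Finset.range (p ^ e), aeval x (n i) * y ^ i) {a : k}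
    (ha : d.eval a = 0) {i : ℕ} (hi : i < p ^ e) : (n i).eval a = 0 := by
  classical
  have hq := pow_pos hp.out.pos e
  have hq2 : 1 < p ^ e := Nat.one_lt_pow S.e_pos.ne' hp.out.one_lt
  by_cases hL : (linearized p e α₁).eval a = 0
  · obtain ⟨P, hx, hy, hxa⟩ := S.exists_place_pole_right hL
    refine Place.eval_eq_zero_of_val_sum_le hq hxa hy (n := n) (m := 1 - (p ^ e : ℕ)) ?_ hi
      (by omega)
    rw [← hn, map_mul]
    have h1 : P.val f ≤ WithZero.exp 1 := by
      refine (hf P).trans ?_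
      have h1 : (1 : ℤᵐ⁰) ≤ WithZero.exp 1 := by
        rw [← WithZero.exp_zero, WithZero.exp_le_exp]; norm_num
      exact max_le (hx.trans h1) (max_le hy.le h1)
    have h2 : P.val (aeval x d) ≤ WithZero.exp (-(p ^ e : ℕ) : ℤ) := by
      obtain ⟨G, hG⟩ := dvd_iff_isRoot.2 ha
      rw [hG, map_mul, map_mul, _root_.map_sub, aeval_X, aeval_C, hxa]
      exact mul_le_of_le_one_right' (Valuation.aeval_le_one P.val_algebraMap_le_one hx G)
    refine (mul_le_mul' h2 h1).trans_eq ?_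
    rw [← WithZero.exp_add]
    congr 1
    ring
  · refine eq_zero_of_forall_sum_mul_pow_eq_zero (u := fun i => (n i).eval a) (card_roots_linearized_add_C (p := p)
      S.α₂_zero_ne S.α₂_e_ne (c / (linearized p e α₁).eval a)) (fun b hb => ?_) hi
    have hb' : (linearized p e α₂).eval b + c / (linearized p e α₁).eval a = 0 := by
      have := isRoot_of_mem_roots (Multiset.mem_toFinset.1 hb)
      simpa using this
    obtain ⟨P, hPa, hPb⟩ := hpt a b (by field_simp at hb'; linear_combination hb')
    have h1 := Place.HasValue.sum (Finset.range (p ^ e))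
      fun i _ => (hPa.aeval_polynomial (n i)).mul (hPb.pow i)
    refine h1.unique ?_
    rw [← hn, Place.hasValue_zero_iff, map_mul]
    have h2 : P.val (aeval x d) < 1 := by
      rw [← Place.hasValue_zero_iff, ← ha]
      exact hPa.aeval_polynomial d
    exact mul_lt_one_of_lt_of_le h2
      ((hf P).trans (max_le hPa.val_le_one (max_le hPb.val_le_one le_rfl)))

/-- Integrality over k[x]: each root of the denominator is a common root of all the nᵢ and can be
divided out, lowering the degree of d. -/
theorem exists_eq_sum
    (hpt : ∀ a b : k, (linearized p e α₁).eval a * (linearized p e α₂).eval b + c = 0 →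
      ∃ P : Place k K, P.HasValue x a ∧ P.HasValue y b) :
    ∃ n : ℕ → k[X], f = ∑ i ∈ Finset.range (p ^ e), aeval x (n i) * y ^ i := by
  obtain ⟨d, hd, n, hn⟩ := S.exists_mul_eq_sum f
  induction hN : d.natDegree generalizing d n with
  | zero =>
    rw [eq_C_of_natDegree_eq_zero hN] at hd hn
    set r := d.coeff 0
    have hr : r ≠ 0 := by rintro h; simp [h] at hd
    refine ⟨fun i => C r⁻¹ * n i, ?_⟩
    rw [aeval_C] at hn
    simp only [map_mul, aeval_C, mul_assoc, ← Finset.mul_sum, ← hn, map_inv₀]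
    rw [inv_mul_cancel_left₀ (by simpa using hr)]
  | succ N ih =>
    obtain ⟨a, ha⟩ := IsAlgClosed.exists_root d
      (by rw [degree_eq_natDegree hd, hN]; exact_mod_cast Nat.succ_ne_zero N)
    have hroot : ∀ i < p ^ e, (n i).IsRoot a := fun i hi =>
      S.eval_eq_zero_of_isRoot hf hpt hn ha hi
    refine ih (d /ₘ (X - C a)) ?_ (fun i => n i /ₘ (X - C a)) ?_ ?_
    · intro h0
      have := mul_divByMonic_eq_iff_isRoot.2 ha
      rw [h0, mul_zero] at this
      exact hd this.symm
    · have hxa : x - algebraMap k K a ≠ 0 := fun h =>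
        S.notMem_range_left ⟨a, (sub_eq_zero.1 h).symm⟩
      apply mul_left_cancel₀ hxa
      have h1 : ∀ G : k[X], G.IsRoot a →
          (x - algebraMap k K a) * aeval x (G /ₘ (X - C a)) = aeval x G := fun G hG => by
        conv_rhs => rw [← mul_divByMonic_eq_iff_isRoot.2 hG]
        simp
      rw [← mul_assoc, h1 d ha, hn, Finset.mul_sum]
      refine Finset.sum_congr rfl fun i hi => ?_
      rw [← mul_assoc, h1 _ (hroot i (Finset.mem_range.1 hi))]
    · rw [natDegree_divByMonic _ (monic_X_sub_C a), natDegree_X_sub_C, hN, Nat.add_sub_cancel]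

/-- Let m be the largest degree. At the pole of x with y = β, the function x^{-m}f has value ∑
coeff_m(nᵢ)βⁱ. If m ≥ 2 this is 0, as f has at most a simple pole. With q roots β available, all
coefficients of degree m vanish, a contradiction. -/
theorem natDegree_le_one {n : ℕ → k[X]}
    (hn : f = ∑ i ∈ Finset.range (p ^ e), aeval x (n i) * y ^ i) {i : ℕ} (hi : i < p ^ e) :
    (n i).natDegree ≤ 1 := by
  classical
  by_contra! hlt
  obtain ⟨i₀, hi₀, hmax⟩ := (Finset.range (p ^ e)).exists_max_image (fun i => (n i).natDegree)
    ⟨i, Finset.mem_range.2 hi⟩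
  set m := (n i₀).natDegree with hm
  have hm2 : 1 < m := hlt.trans_le (hmax i (Finset.mem_range.2 hi))
  have h0 : (n i₀).coeff m = 0 := by
    refine eq_zero_of_forall_sum_mul_pow_eq_zero (u := fun i => (n i).coeff m)
      (card_roots_linearized_add_C (p := p) S.α₂_zero_ne S.α₂_e_ne 0) (fun β hβ => ?_)
      (Finset.mem_range.1 hi₀)
    have hβ' : (linearized p e α₂).eval β = 0 := by
      have := isRoot_of_mem_roots (Multiset.mem_toFinset.1 hβ)
      simpa using this
    obtain ⟨P, hy, hx, hyβ⟩ := S.symm.exists_place_pole_right hβ'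
    have hPβ : P.HasValue y β := by
      rw [Place.HasValue, hyβ, ← WithZero.exp_zero, WithZero.exp_lt_exp]
      have := pow_pos hp.out.pos e
      omega
    have hx0 : x ≠ 0 := fun h => S.notMem_range_left ⟨0, by rw [h, map_zero]⟩
    have hxi : P.val x⁻¹ = WithZero.exp (-1) := by rw [map_inv₀, hx, WithZero.exp_neg]
    have hu : P.HasValue x⁻¹ 0 := by
      rw [Place.hasValue_zero_iff, hxi, ← WithZero.exp_zero, WithZero.exp_lt_exp]
      norm_num
    have h1 := Place.HasValue.sum (Finset.range (p ^ e)) fun i hi =>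
      (hu.inv_pow_mul_aeval hx0 (hmax i hi)).mul (hPβ.pow i)
    refine h1.unique ?_
    simp only [mul_assoc]
    rw [← Finset.mul_sum, ← hn, Place.hasValue_zero_iff, map_mul, map_pow, hxi,
      ← WithZero.exp_nsmul]
    have h2 : P.val f ≤ WithZero.exp 1 := by
      refine (hf P).trans ?_
      have h1 : (1 : ℤᵐ⁰) ≤ WithZero.exp 1 := by
        rw [← WithZero.exp_zero, WithZero.exp_le_exp]; norm_num
      exact max_le hx.le (max_le (hy.trans h1) h1)
    refine (mul_le_mul' le_rfl h2).trans_lt ?_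
    rw [← WithZero.exp_add, ← WithZero.exp_zero, WithZero.exp_lt_exp]
    simp
    omega
  rw [hm, coeff_natDegree, leadingCoeff_eq_zero] at h0
  rw [hm, h0, natDegree_zero] at hm2
  omega

/-- At the pole of y over each of the q roots a of L₁, the bound 1 on the pole order of f forces
nᵢ(a) = 0 for i > 1, too many roots for a polynomial of degree at most 1. -/
theorem eq_zero_of_one_lt {n : ℕ → k[X]}
    (hn : f = ∑ i ∈ Finset.range (p ^ e), aeval x (n i) * y ^ i) {i : ℕ} (hi : i < p ^ e)
    (h1i : 1 < i) : n i = 0 := by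
  classical
  refine eq_zero_of_natDegree_lt_card_of_eval_eq_zero' (n i)
    (linearized p e α₁ + C 0).roots.toFinset (fun a ha => ?_) ?_
  · have ha' : (linearized p e α₁).eval a = 0 := by
      have := isRoot_of_mem_roots (Multiset.mem_toFinset.1 ha)
      simpa using this
    obtain ⟨P, hx, hy, hxa⟩ := S.exists_place_pole_right ha'
    refine Place.eval_eq_zero_of_val_sum_le (pow_pos hp.out.pos e) hxa hy (n := n) (m := 1) ?_ hi
      (by exact_mod_cast h1i)
    rw [← hn]
    refine (hf P).trans ?_
    have h1 : (1 : ℤᵐ⁰) ≤ WithZero.exp 1 := by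
      rw [← WithZero.exp_zero, WithZero.exp_le_exp]; norm_num
    exact max_le (hx.trans h1) (max_le hy.le h1)
  · rw [card_roots_linearized_add_C S.α₁_zero_ne S.α₁_e_ne]
    exact (S.natDegree_le_one hf hn hi).trans_lt (h1i.trans hi)

theorem mem_span
    (hpt : ∀ a b : k, (linearized p e α₁).eval a * (linearized p e α₂).eval b + c = 0 →
      ∃ P : Place k K, P.HasValue x a ∧ P.HasValue y b) :
    f ∈ Submodule.span k {1, x, y, x * y} := by
  obtain ⟨n, hn⟩ := S.exists_eq_sum hf hpt
  have hq2 : 2 ≤ p ^ e := Nat.one_lt_pow S.e_pos.ne' hp.out.one_lt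
  have h2 : f = ∑ i ∈ Finset.range 2, aeval x (n i) * y ^ i := by
    refine hn.trans (Finset.sum_subset (Finset.range_mono hq2) fun i hi hi' => ?_).symm
    rw [Finset.mem_range] at hi hi'
    rw [S.eq_zero_of_one_lt hf hn hi (by omega), map_zero, zero_mul]
  obtain ⟨a, b, h0⟩ := exists_eq_X_add_C_of_natDegree_le_one
    (S.natDegree_le_one hf hn (i := 0) (by omega))
  obtain ⟨a', b', h1⟩ := exists_eq_X_add_C_of_natDegree_le_one
    (S.natDegree_le_one hf hn (i := 1) (by omega))
  have h3 : f = a • x + b • 1 + a' • (x * y) + b' • y := by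
    rw [h2, Finset.sum_range_succ, Finset.sum_range_one, h0, h1]
    simp [Algebra.smul_def]
    ring
  have hmem : ∀ z ∈ ({1, x, y, x * y} : Set K), z ∈ Submodule.span k {1, x, y, x * y} :=
    fun z hz => Submodule.subset_span hz
  rw [h3]
  exact add_mem (add_mem (add_mem (Submodule.smul_mem _ _ (hmem _ (by simp)))
    (Submodule.smul_mem _ _ (hmem _ (by simp)))) (Submodule.smul_mem _ _ (hmem _ (by simp))))
    (Submodule.smul_mem _ _ (hmem _ (by simp)))

end RiemannRoch

end GenASM.Generators

/-! ### The divisor D and its complete linear system -/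

namespace AlgCurve

variable {k K : Type*} [Field k] [Field K] [Algebra k K]

theorem Place.exp_neg_minOrd {n : ℕ} (P : Place k K) {f : Fin (n + 1) → K} {i : Fin (n + 1)}
    (hi : f i ≠ 0) : WithZero.exp (-P.minOrd f) = Finset.univ.sup fun i => P.val (f i) := by
  rw [Place.minOrd, neg_neg, WithZero.exp_log]
  intro h
  have := Finset.le_sup (f := fun i => P.val (f i)) (Finset.mem_univ i)
  rw [h] at this
  simp [hi] at this

theorem Place.le_exp_iff {P : Place k K} {g : K} (hg : g ≠ 0) {m : ℤ} :
    P.val g ≤ WithZero.exp m ↔ 0 ≤ m + P.ord g := by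
  rw [← WithZero.log_le_iff_le_exp (by simpa using hg), Place.ord]
  omega

end AlgCurve

namespace GenASM

variable {k : Type*} [Field k] [IsAlgClosed k] (p : ℕ) [hp : Fact p.Prime] [CharP k p]
  (S : GenASM k)

omit [IsAlgClosed k] [CharP k p] in
theorem exp_lineDivisor (P : S.Curve p) : WithZero.exp (S.lineDivisor p P) =
    max (P.val (S.x p)) (max (P.val (S.y p)) 1) := by
  have h1 : S.lineDivisor p P = -P.minOrd ![S.x p, S.y p, 1] := by
    simp [lineDivisor, hyperplaneDivisor, Fin.sum_univ_three, Place.ord]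
  rw [h1, P.exp_neg_minOrd (i := 2) (by simp)]
  simp [Fin.univ_succ]

/-- Adjoining xy to (x, y, 1) does not change the smallest order, so plane sections under the map to
ℙ³ are still measured against D. -/
theorem exp_neg_minOrd (P : S.Curve p) :
    WithZero.exp (-P.minOrd ![S.x p, S.y p, 1, S.x p * S.y p]) =
      WithZero.exp (S.lineDivisor p P) := by
  rw [exp_lineDivisor, P.exp_neg_minOrd (i := 2) (by simp)]
  have h := (S.generators p).val_mul_le P
  apply le_antisymm
  · refine Finset.sup_le fun i _ => ?_
    fin_cases i
    · exact le_max_left _ _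
    · exact le_max_of_le_right (le_max_left _ _)
    · exact (map_one P.val).le.trans (le_max_of_le_right (le_max_right _ _))
    · exact h
  · have hle := fun i => Finset.le_sup
      (f := fun i => P.val (![S.x p, S.y p, 1, S.x p * S.y p] i)) (Finset.mem_univ i)
    exact max_le (hle 0) (max_le (hle 1) ((map_one P.val).ge.trans (hle 2)))

theorem exists_place_point {a b : k}
    (hab : (linearized p S.e S.α₁).eval a * (linearized p S.e S.α₂).eval b + S.c = 0) :
    ∃ P : S.Curve p, P.HasValue (S.x p) a ∧ P.HasValue (S.y p) b := by
  obtain ⟨V, hk, ha, hb⟩ := S.exists_valuationSubring_point p hab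
  have hV : V ≠ ⊤ := ValuationSubring.ne_top_of_valuation_lt_one
    (fun h => (S.generators p).notMem_range_left ⟨a, (sub_eq_zero.1 h).symm⟩) ha
  let P : S.Curve p := ⟨V, ((S.generators p).exists_chart hk hV).1, hk⟩
  exact ⟨P, (P.val_lt_one_iff _).2 ha, (P.val_lt_one_iff _).2 hb⟩

theorem riemannRochSpace_lineDivisor : riemannRochSpace (S.lineDivisor p) =
    Submodule.span k {1, S.x p, S.y p, S.x p * S.y p} := by
  apply le_antisymm
  · intro f hf
    exact (S.generators p).mem_span (fun P => (hf P).trans_eq (S.exp_lineDivisor p P))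
      fun a b hab => S.exists_place_point p hab
  · rw [Submodule.span_le]
    intro f hf P
    rw [exp_lineDivisor]
    rcases hf with rfl | rfl | rfl | rfl
    · rw [map_one]
      exact le_max_of_le_right (le_max_right _ _)
    · exact le_max_left _ _
    · exact le_max_of_le_right (le_max_left _ _)
    · exact (S.generators p).val_mul_le P

theorem finite_support_lineDivisor : (Function.support (S.lineDivisor p)).Finite := by
  refine ((S.generators p).finite_pole_left.union (S.generators p).symm.finite_pole_left).subset ?_
  intro P hP
  by_contra h
  rw [Set.mem_union, not_or, Set.mem_ofPred_eq, Set.mem_ofPred_eq] at h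
  have h1 := S.exp_lineDivisor p P
  rw [max_eq_right (a := P.val (S.y p)) (not_lt.1 h.2),
    max_eq_right (not_lt.1 h.1), WithZero.exp_eq_one] at h1
  exact hP h1

theorem inducedLinearSystem_eq :
    inducedLinearSystem k ![S.x p, S.y p, 1, S.x p * S.y p] =
      completeLinearSystem (S.lineDivisor p) := by
  set f := ![S.x p, S.y p, 1, S.x p * S.y p] with hfdef
  have hspan : riemannRochSpace (S.lineDivisor p) = Submodule.span k (Set.range f) := by
    rw [S.riemannRochSpace_lineDivisor p]
    congr 1
    ext z
    simp [hfdef]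
    tauto
  -- Plane sections are D + div(∑ aᵢfᵢ), so both inclusions reduce to L(D) being the span of the
  -- coordinates.
  have hdiv : ∀ (a : Fin 4 → k) (P : S.Curve p),
      hyperplaneDivisor f a P = S.lineDivisor p P + P.ord (∑ i, a i • f i) := by
    intro a P
    have := WithZero.exp_injective (S.exp_neg_minOrd p P)
    rw [hyperplaneDivisor, ← this]
    ring
  have hmem : ∀ g : S.FunctionField p, g ≠ 0 → (g ∈ Submodule.span k (Set.range f) ↔
      ∀ P : S.Curve p, 0 ≤ S.lineDivisor p P + P.ord g) := by
    intro g hg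
    rw [← hspan]
    exact forall_congr' fun P => Place.le_exp_iff hg
  ext E
  constructor
  · rintro ⟨a, ha, rfl⟩
    have h1 := (hmem _ ha).1 ((Submodule.mem_span_range_iff_exists_fun k).2 ⟨a, rfl⟩)
    refine ⟨fun P => ?_, _, ha, hdiv a⟩
    rw [hdiv]
    exact h1 P
  · rintro ⟨hE, g, hg, h⟩
    obtain ⟨a, rfl⟩ := (Submodule.mem_span_range_iff_exists_fun k).1 ((hmem g hg).2 fun P => by
      rw [← h]; exact hE P)
    exact ⟨a, hg, funext fun P => by rw [h, hdiv]⟩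

end GenASM

theorem lemma2p4 {k : Type*} [Field k] [IsAlgClosed k] (p : ℕ) [Fact p.Prime] [CharP k p]
    (S : GenASM k) :
    -- the map `(x : y : 1 : xy)` is defined at every point of the curve and is an embedding
    (∃ φ : S.Curve p → ℙ k (Fin 4 → k),
      (∀ (P : S.Curve p) (r : ℙ k (Fin 4 → k)),
        P.MapsTo ![S.x p, S.y p, 1, S.x p * S.y p] r ↔ r = φ P) ∧
      AlgCurve.IsEmbedding φ) ∧
    -- `D` is a divisor, and the linear system induced by the map is the complete one `|D|`
    (Function.support (S.lineDivisor p)).Finite ∧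
    AlgCurve.inducedLinearSystem k ![S.x p, S.y p, 1, S.x p * S.y p] =
      AlgCurve.completeLinearSystem (S.lineDivisor p) ∧
    AlgCurve.riemannRochSpace (S.lineDivisor p) =
      Submodule.span k {1, S.x p, S.y p, S.x p * S.y p} :=
  ⟨(S.generators p).exists_isEmbedding, S.finite_support_lineDivisor p,
    S.inducedLinearSystem_eq p, S.riemannRochSpace_lineDivisor p⟩
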